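/- **Theorem.** Let $\omega_1,\omega_2\in\mathbb{C}$ be linearly independent over $\mathbb{R}$, let $\Lambda=\mathbb{Z}\omega_1+\mathbb{Z}\omega_2$, and let $E=\mathbb{C}/\Lambda$ be the corresponding complex elliptic curve, with the holomorphic form $dz$ and the involution $\sigma(P)=-P$. Let $K=E[2]$ be the group of $2$-torsion points, which are the fixed points of $\sigma$, and let $D=\sum_{P\in K}P$. Let $V=H^0(E,\mathcal{O}_E(D))^-$ be the space of meromorphic functions $f$ on $E$ with $f\circ\sigma=-f$ whose only poles are at most simple poles at points of $K$. For $f\in V$ the form $f^2\,dz$ has no residues, so it has a de Rham class $\Psi(f)\in H^1(E,\mathbb{C})=\operatorname{Hom}(H_1(E,\mathbb{Z}),\mathbb{C})$, given by its periods. Choose any basis of $H^1(E,\mathbb{C})\cong\mathbb{C}^2$, let $\psi_1,\psi_2$ be the components of $\Psi$ in this basis, let $\mathcal{Q}_i\subset\mathbb{P}(V)$ be the conic with equation $\psi_i=0$, and set $\Theta=\mathcal{Q}_1\cap\mathcal{Q}_2$. Then: 1. $\dim V=3$, that is, $\mathbb{P}(V)\cong\mathbb{P}^2$, and $K\cong(\mathbb{Z}/2)^2$;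 2. $\Theta$ is the locus of those $[f]\in\mathbb{P}(V)$ for which there is $h\in V$ with $dh=f^2\,dz$; 3. $\Theta$ consists of exactly $4$ distinct points; 4. these points form a single orbit for the action of $K$ on $\mathbb{P}(V)$ by translation, $(P\cdot f)(Q)=f(Q+P)$. -/

import Mathlib

open scoped LinearAlgebra.Projectivization

noncomputable section

namespace OddElliptic

/-- The complex elliptic curve `ℂ / Λ`, where `Λ = ℤ ω₁ + ℤ ω₂`. -/
abbrev Curve (L : PeriodPair) : Type := ℂ ⧸ L.lattice

/-- The `2`-torsion subgroup `K` of the elliptic curve. -/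
abbrev TwoTorsion (L : PeriodPair) : AddSubgroup (Curve L) :=
  AddSubgroup.torsionBy (Curve L) 2

/-- The pullback to `ℂ` of a function on the elliptic curve. -/
def pull (L : PeriodPair) (f : Curve L → ℂ) (z : ℂ) : ℂ := f (Submodule.Quotient.mk z)

/-- `V = H⁰(E, 𝒪_E(D))⁻`, where `D` is the sum of the four `2`-torsion points: the functions on `E`
that are holomorphic off the `2`-torsion points, meromorphic with at most a simple pole at the
`2`-torsion points, and anti-invariant under `P ↦ -P`.

A meromorphic function on `E` is represented here by a function `E → ℂ`.  The representative is
unique: off the support of `D` its values are the true ones, and at a `2`-torsion point `P = -P` the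
identity `f (-P) = - f P` forces the value `0`, both at a pole (where `0` is a conventional value)
and at a regular point (where the true value is `0` by anti-invariance). -/
def V (L : PeriodPair) : Submodule ℂ (Curve L → ℂ) where
  carrier := {f |
    (∀ P, f (-P) = - f P) ∧
    (∀ z : ℂ, Submodule.Quotient.mk z ∉ TwoTorsion L → AnalyticAt ℂ (pull L f) z) ∧
    (∀ z : ℂ, Submodule.Quotient.mk z ∈ TwoTorsion L →
      MeromorphicAt (pull L f) z ∧ (-1 : ℤ) ≤ meromorphicOrderAt (pull L f) z)}
  zero_mem' := by
    refine ⟨fun P => by simp, fun z _ => ?_, fun z _ => ?_⟩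
    · exact analyticAt_const (v := (0 : ℂ))
    · refine ⟨MeromorphicAt.const (0 : ℂ) z, ?_⟩
      have h : meromorphicOrderAt (pull L 0) z = ⊤ := by
        rw [meromorphicOrderAt_eq_top_iff]
        exact Filter.Eventually.of_forall fun _ => rfl
      rw [h]
      exact le_top
  add_mem' := by
    rintro f g ⟨hf1, hf2, hf3⟩ ⟨hg1, hg2, hg3⟩
    refine ⟨fun P => ?_, fun z hz => (hf2 z hz).add (hg2 z hz), fun z hz =>
      ⟨(hf3 z hz).1.add (hg3 z hz).1, ?_⟩⟩
    · simp only [Pi.add_apply, hf1 P, hg1 P]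
      ring
    · exact (le_min (hf3 z hz).2 (hg3 z hz).2).trans
        (meromorphicOrderAt_add (hf3 z hz).1 (hg3 z hz).1)
  smul_mem' := by
    rintro c f ⟨hf1, hf2, hf3⟩
    refine ⟨fun P => ?_, fun z hz => analyticAt_const.mul (hf2 z hz), fun z hz =>
      ⟨(MeromorphicAt.const c z).mul (hf3 z hz).1, ?_⟩⟩
    · simp [hf1 P]
    · have h := meromorphicOrderAt_mul (MeromorphicAt.const c z) (hf3 z hz).1
      have h0 : (0 : WithTop ℤ) ≤ meromorphicOrderAt (fun _ : ℂ => c) z :=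
        (analyticAt_const (v := c)).meromorphicOrderAt_nonneg
      calc ((-1 : ℤ) : WithTop ℤ) ≤ meromorphicOrderAt (pull L f) z := (hf3 z hz).2
        _ ≤ meromorphicOrderAt (fun _ : ℂ => c) z + meromorphicOrderAt (pull L f) z :=
          le_add_of_nonneg_left h0
        _ = _ := h.symm

/-- `dh = f² dz`, as an identity of meromorphic forms on `E`.  It is tested off the finitely many
`2`-torsion points, which contain all poles of `f` and `h`. -/
def IsSolution (L : PeriodPair) (f h : V L) : Prop :=
  ∀ z : ℂ, Submodule.Quotient.mk z ∉ TwoTorsion L →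
    HasDerivAt (pull L h) (pull L f z ^ 2) z

/-- `H¹(E, ℂ) = Hom(H₁(E, ℤ), ℂ)`, where `H₁(E, ℤ) = Λ`. -/
abbrev H1 (L : PeriodPair) : Type := L.lattice →ₗ[ℤ] ℂ

/-- The periods `∫_{γ_i} f² dz` of the form `f² dz`, where `γ₁`, `γ₂` are the loops in `E` that are
the images of the segments `[ω₂/4, ω₂/4 + ω₁]` and `[ω₁/4, ω₁/4 + ω₂]`.  These loops avoid the
`2`-torsion points, and their classes are the generators `ω₁`, `ω₂` of `H₁(E, ℤ) = Λ`. -/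
def period (L : PeriodPair) (f : V L) : Fin 2 → ℂ :=
  ![∫ t in (0 : ℝ)..1, pull L f (L.ω₂ / 4 + t * L.ω₁) ^ 2 * L.ω₁,
    ∫ t in (0 : ℝ)..1, pull L f (L.ω₁ / 4 + t * L.ω₂) ^ 2 * L.ω₂]

/-- The map `Ψ : V → H¹(E, ℂ)` that sends `f` to the de Rham class of `f² dz`.  As `f` is odd about
each `2`-torsion point, `f² dz` has no residues, so that it has a class in `H¹(E, ℂ)`; the class is
the homomorphism `H₁(E, ℤ) → ℂ` given by the periods. -/
def Psi (L : PeriodPair) (f : V L) : H1 L := L.latticeBasis.constr ℤ (period L f)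

/-- The quadric of `ℙ(V)` with equation `ℓ (Ψ f) = 0`, for a linear form `ℓ` on `H¹(E, ℂ)`. -/
def quadric (L : PeriodPair) (l : H1 L →ₗ[ℂ] ℂ) : Set (ℙ ℂ (V L)) :=
  {p | ∀ f ∈ p.submodule, l (Psi L f) = 0}

/-- `Θ = 𝒬₁ ∩ 𝒬₂`, where `𝒬₁`, `𝒬₂` are given by the two components `ψ₁`, `ψ₂` of `Ψ` with respect
to a basis of `H¹(E, ℂ)`. -/
def Theta (L : PeriodPair) (b : Module.Basis (Fin 2) ℂ (H1 L)) : Set (ℙ ℂ (V L)) :=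
  quadric L (b.coord 0) ∩ quadric L (b.coord 1)

/-- The locus of the `[f]` in `ℙ(V)` such that `dh = f² dz` for some `h ∈ V`. -/
def solutionLocus (L : PeriodPair) : Set (ℙ ℂ (V L)) :=
  {p | ∀ f ∈ p.submodule, ∃ h : V L, IsSolution L f h}

theorem translate_mem (L : PeriodPair) (P : Curve L) (hP : P ∈ TwoTorsion L) (f : Curve L → ℂ)
    (hf : f ∈ V L) : (fun Q => f (Q + P)) ∈ V L := by
  obtain ⟨hf1, hf2, hf3⟩ := hf
  obtain ⟨w, rfl⟩ := Submodule.Quotient.mk_surjective _ P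
  have hpull : pull L (fun Q => f (Q + Submodule.Quotient.mk w)) = fun z => pull L f (z + w) := by
    funext z
    simp [pull]
  have hneg : -(Submodule.Quotient.mk w : Curve L) = Submodule.Quotient.mk w := by
    have h : (2 : ℤ) • (Submodule.Quotient.mk w : Curve L) = 0 := by simpa using hP
    rw [two_zsmul] at h
    exact neg_eq_of_add_eq_zero_left h
  have hmem : ∀ z : ℂ, (Submodule.Quotient.mk (z + w) : Curve L) ∈ TwoTorsion L ↔
      (Submodule.Quotient.mk z : Curve L) ∈ TwoTorsion L := fun z => by
    rw [Submodule.Quotient.mk_add]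
    exact (TwoTorsion L).add_mem_cancel_right hP
  refine ⟨fun Q => ?_, fun z hz => ?_, fun z hz => ?_⟩
  · have h : -Q + (Submodule.Quotient.mk w : Curve L) = -(Q + Submodule.Quotient.mk w) := by
      rw [neg_add, hneg]
    show f (-Q + _) = - f (Q + _)
    rw [h, hf1]
  · rw [hpull]
    exact (hf2 (z + w) (mt (hmem z).1 hz)).fun_comp (f := fun z => z + w)
      (analyticAt_id.add analyticAt_const)
  · rw [hpull]
    obtain ⟨h1, h2⟩ := hf3 (z + w) ((hmem z).2 hz)
    refine ⟨h1.comp_analyticAt (g := fun z => z + w) (analyticAt_id.add analyticAt_const), ?_⟩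
    exact h2.trans_eq meromorphicOrderAt_fun_comp_add_const_eq_meromorphicOrderAt.symm

/-- The action of the `2`-torsion points on `V` by translation: `(P • f) Q = f (Q + P)`. By
functoriality it induces an action on `ℙ(V)`. -/
instance (L : PeriodPair) : DistribMulAction (Multiplicative (TwoTorsion L)) (V L) where
  smul P f := ⟨fun Q => f.1 (Q + (P.toAdd : Curve L)), translate_mem L _ P.toAdd.2 f.1 f.2⟩
  one_smul f := Subtype.ext (funext fun Q => congrArg f.1 (add_zero Q))
  mul_smul P P' f := Subtype.ext (funext fun Q => congrArg f.1 (by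
    simp [add_assoc]))
  smul_zero _ := rfl
  smul_add _ _ _ := rfl

instance (L : PeriodPair) : SMulCommClass (Multiplicative (TwoTorsion L)) ℂ (V L) where
  smul_comm _ _ _ := rfl

end OddElliptic

end

/-! Let `w`, `u`, `v` be half periods representing the three points of order two, and let `e_w`,
`e_u`, `e_v` be the values of `℘` there. The functions `φ_w = ℘' / (2 (℘ - e_w))`, `φ_u`, `φ_v` lie
in `V`. Each has simple poles exactly at `0` and at its own half period. Subtracting multiples of
them from any `f` in `V` leaves an odd elliptic function with at most a simple pole at `0`, and this
vanishes (`eq_zero_of_odd`). Hence they form a basis (`exists_eq_linear_combination`,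
`eq_zero_of_linear_relation`).

Two identities compute squares modulo derivatives of elements of `V`: `φ_w φ_u = ℘ - e_v` and `φ_w'
= 2 ℘ + e_w - φ_w ^ 2` (`halfLogDeriv_mul`, `hasDerivAt_halfLogDeriv`). Translation by `w` sends
`φ_w` to `-φ_w` and `φ_u` to `φ_v - φ_w`. So `V` is the sum of the three nontrivial characters of
`K`. In the eigenbasis with coordinates `c`, `hasDerivAt_pull_ofCoords_sq` says that `f ^ 2` differs
from `4 (∑ c_i ^ 2) ℘ - 4 ∑ e_i c_i ^ 2` by `k'` with `k` in `V`. The classes of `℘ dz` and `dz` are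
independent (`eq_zero_of_periods_eq_zero`), so the class of `f ^ 2 dz` vanishes exactly when both
sums vanish, and then `k` itself solves `dh = f ^ 2 dz`.

The `e_i` are distinct, so the two equations fix the squares `c_i ^ 2` up to a common factor and
make them all nonzero. Only the signs remain free: four projective points, which `K` permutes simply
transitively by changing two signs at a time. -/

section

open Filter Topology

/-! ### Local behaviour of meromorphic functions that are odd or even about a point -/

section Meromorphic

theorem WithTop.add_one_le_of_lt_int {n : ℤ} {x : WithTop ℤ} (h : (n : WithTop ℤ) < x) :
    ((n + 1 : ℤ) : WithTop ℤ) ≤ x := by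
  cases x with
  | top => exact le_top
  | coe k => exact_mod_cast Int.add_one_le_of_lt (by exact_mod_cast h)

/-- If `g` has order exactly `n` and `f` has order at least `n`, then a suitable multiple of `g`
cancels the leading term of `f`. -/
theorem exists_lt_meromorphicOrderAt_sub_smul {f g : ℂ → ℂ} {x : ℂ} {n : ℤ}
    (hf : MeromorphicAt f x) (hg : MeromorphicAt g x) (hgn : meromorphicOrderAt g x = n)
    (hfn : (n : WithTop ℤ) ≤ meromorphicOrderAt f x) :
    ∃ a : ℂ, ((n + 1 : ℤ) : WithTop ℤ) ≤ meromorphicOrderAt (fun z => f z - a * g z) x := by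
  have hq : (0 : WithTop ℤ) ≤ meromorphicOrderAt (f / g) x := by
    rw [meromorphicOrderAt_div hf hg, hgn]
    cases h : meromorphicOrderAt f x with
    | top => simp
    | coe k =>
      rw [h] at hfn
      have : n ≤ k := by exact_mod_cast hfn
      have h2 : ((k : WithTop ℤ) - (n : WithTop ℤ)) = ((k - n : ℤ) : WithTop ℤ) := by norm_cast
      rw [h2]
      exact_mod_cast sub_nonneg.2 this
  -- The multiple is the limit of `f / g` at `x`, so that `f / g - a` has positive order.
  obtain ⟨a, ha⟩ := tendsto_nhds_of_meromorphicOrderAt_nonneg (hf.div hg) hq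
  refine ⟨a, ?_⟩
  have hg0 : ∀ᶠ z in 𝓝[≠] x, g z ≠ 0 :=
    (meromorphicOrderAt_ne_top_iff_eventually_ne_zero hg).1 (by simp [hgn])
  have hm : MeromorphicAt (fun z => (f / g) z - a) x := (hf.div hg).sub (.const a x)
  have hpos : 0 < meromorphicOrderAt (fun z => (f / g) z - a) x := by
    rw [← tendsto_zero_iff_meromorphicOrderAt_pos hm]
    simpa using ha.sub_const a
  have hcongr : (fun z => f z - a * g z) =ᶠ[𝓝[≠] x] (fun z => (f / g) z - a) * g := by
    filter_upwards [hg0] with z hz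
    simp only [Pi.div_apply, Pi.mul_apply]
    field_simp
  rw [meromorphicOrderAt_congr hcongr, meromorphicOrderAt_mul hm hg, hgn, add_comm]
  push_cast
  have : ((0 + 1 : ℤ) : WithTop ℤ) ≤ meromorphicOrderAt (fun z => (f / g) z - a) x :=
    WithTop.add_one_le_of_lt_int (by exact_mod_cast hpos)
  gcongr
  simpa using this

theorem tendsto_reflect_nhdsNE (c : ℂ) :
    Tendsto (fun z : ℂ => 2 * c - z) (𝓝[≠] c) (𝓝[≠] c) := by
  refine tendsto_nhdsWithin_of_tendsto_nhds_of_eventually_within _ ?_ ?_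
  · have : Tendsto (fun z : ℂ => 2 * c - z) (𝓝 c) (𝓝 (2 * c - c)) :=
      (continuous_const.sub continuous_id).tendsto c
    rw [show 2 * c - c = c by ring] at this
    exact this.mono_left nhdsWithin_le_nhds
  · filter_upwards [self_mem_nhdsWithin] with z (hz : z ≠ c) (h : 2 * c - z = c)
    exact hz (by linear_combination -h)

theorem tendsto_add_const_nhdsNE (c w : ℂ) :
    Tendsto (fun z : ℂ => z + w) (𝓝[≠] c) (𝓝[≠] (c + w)) := by
  refine tendsto_nhdsWithin_of_tendsto_nhds_of_eventually_within _ ?_ ?_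
  · exact ((continuous_id.add continuous_const).tendsto c).mono_left nhdsWithin_le_nhds
  · filter_upwards [self_mem_nhdsWithin] with z (hz : z ≠ c) (h : z + w = c + w)
    exact hz (add_right_cancel h)

/-- A meromorphic function that is odd about `c` and bounded near `c` is analytic at `c`. -/
theorem analyticAt_of_odd {f : ℂ → ℂ} {c : ℂ} (hf : MeromorphicAt f c)
    (hle : 0 ≤ meromorphicOrderAt f c) (hodd : ∀ z, f (2 * c - z) = -f z) :
    AnalyticAt ℂ f c := by
  obtain ⟨r, hr⟩ := tendsto_nhds_of_meromorphicOrderAt_nonneg hf hle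
  have hneg : Tendsto f (𝓝[≠] c) (𝓝 (-r)) := by
    refine (hr.comp (tendsto_reflect_nhdsNE c)).neg.congr fun z => ?_
    simp only [Function.comp_apply, hodd, neg_neg]
  have hr0 : r = 0 := CharZero.eq_neg_self_iff.1 (tendsto_nhds_unique hr hneg)
  -- Oddness holds at `c` itself, so the actual value, and not only the limit, is `0`. This is why
  -- `f` needs no redefinition at `c`.
  have hc0 : f c = 0 := by
    rw [← CharZero.eq_neg_self_iff, ← hodd]
    ring_nf
  refine hf.analyticAt (continuousAt_iff_punctured_nhds.2 ?_)
  rw [hc0, ← hr0]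
  exact hr

/-- A meromorphic function that is even about `c` has no simple pole at `c`. -/
theorem meromorphicOrderAt_nonneg_of_even {f : ℂ → ℂ} {c : ℂ} (hf : MeromorphicAt f c)
    (hle : ((-1 : ℤ) : WithTop ℤ) ≤ meromorphicOrderAt f c) (heven : ∀ z, f (2 * c - z) = f z) :
    0 ≤ meromorphicOrderAt f c := by
  have hid : MeromorphicAt (fun z : ℂ => z - c) c := by fun_prop
  have hid1 : meromorphicOrderAt (fun z : ℂ => z - c) c = 1 := meromorphicOrderAt_id_sub_const
  -- The limit of `(z - c) * f z` is the residue. This product is odd about `c`, so the residue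
  -- equals its own negative.
  have hm : MeromorphicAt (fun z => (z - c) * f z) c := hid.mul hf
  have hord : meromorphicOrderAt (fun z => (z - c) * f z) c = 1 + meromorphicOrderAt f c := by
    rw [← hid1]; exact meromorphicOrderAt_mul hid hf
  have hnn : 0 ≤ meromorphicOrderAt (fun z => (z - c) * f z) c := by
    rw [hord]
    calc (0 : WithTop ℤ) = 1 + ((-1 : ℤ) : WithTop ℤ) := by norm_cast
      _ ≤ _ := by gcongr
  obtain ⟨r, hr⟩ := tendsto_nhds_of_meromorphicOrderAt_nonneg hm hnn
  have hneg : Tendsto (fun z => (z - c) * f z) (𝓝[≠] c) (𝓝 (-r)) := by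
    have := (hr.comp (tendsto_reflect_nhdsNE c)).neg
    refine this.congr fun z => ?_
    simp only [Function.comp_apply, heven]
    ring
  have hr0 : r = 0 := CharZero.eq_neg_self_iff.1 (tendsto_nhds_unique hr hneg)
  rw [hr0, tendsto_zero_iff_meromorphicOrderAt_pos hm, hord] at hr
  cases h : meromorphicOrderAt f c with
  | top => simp
  | coe k =>
    rw [h] at hr
    have : (0 : ℤ) < 1 + k := by exact_mod_cast hr
    exact_mod_cast (show (0 : ℤ) ≤ k by omega)

end Meromorphic

/-! ### Liouville's theorem and the values of `℘` at half periods -/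

namespace PeriodPair

variable (L : PeriodPair)

/-- Liouville's theorem for elliptic functions. -/
theorem eq_const_of_meromorphicOrderAt_nonneg {G : ℂ → ℂ}
    (hper : ∀ l ∈ L.lattice, ∀ z, G (z + l) = G z) (hmer : ∀ z, MeromorphicAt G z)
    (hord : ∀ z, 0 ≤ meromorphicOrderAt G z) :
    ∃ c, ∀ z, AnalyticAt ℂ G z → G z = c := by
  have hon : MeromorphicOn G Set.univ := fun z _ => hmer z
  -- The normal form fills in the removable singularities. Periodicity passes to it by continuity,
  -- since it agrees with `G` on punctured neighbourhoods.
  set H := toMeromorphicNFOn G Set.univ with hH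
  have hHa : ∀ z, AnalyticAt ℂ H z := fun z => by
    refine (meromorphicNFOn_toMeromorphicNFOn G Set.univ
      (Set.mem_univ z)).meromorphicOrderAt_nonneg_iff_analyticAt.1 ?_
    rw [meromorphicOrderAt_toMeromorphicNFOn hon (Set.mem_univ z)]
    exact hord z
  have hHG : ∀ z, H =ᶠ[𝓝[≠] z] G := fun z =>
    hon.toMeromorphicNFOn_eq_self_on_nhdsNE (Set.mem_univ z)
  have hHd : Differentiable ℂ H := fun z => (hHa z).differentiableAt
  have hHper : ∀ z, ∀ l ∈ L.lattice, H (z + l) = H z := fun z l hl => by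
    have h1 : ContinuousAt (fun w => H (w + l)) z :=
      (hHd.continuous.comp (continuous_id.add continuous_const)).continuousAt
    have h2 : (fun w => H (w + l)) =ᶠ[𝓝[≠] z] H := by
      filter_upwards [(tendsto_add_const_nhdsNE z l).eventually (hHG (z + l)), hHG z] with w hw hw'
      rw [hw, hw', hper l hl]
    exact ((ContinuousAt.eventuallyEq_nhds_iff_eventuallyEq_nhdsNE h1
      hHd.continuous.continuousAt).1 h2).eq_of_nhds
  refine ⟨H 0, fun z hz => ?_⟩
  have h3 : H z = G z := ((ContinuousAt.eventuallyEq_nhds_iff_eventuallyEq_nhdsNE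
    hHd.continuous.continuousAt hz.continuousAt).1 (hHG z)).eq_of_nhds
  rw [← h3]
  exact hHd.apply_eq_apply_of_bounded (IsZLattice.isCompact_range_of_periodic L.lattice _
    hHd.continuous fun z w hw => hHper z w hw).isBounded z 0

end PeriodPair

namespace PeriodPair

variable {L : PeriodPair}

theorem weierstrassP_add_mem (z : ℂ) {l : ℂ} (hl : l ∈ L.lattice) :
    L.weierstrassP (z + l) = L.weierstrassP z :=
  L.weierstrassP_add_coe z ⟨l, hl⟩

theorem derivWeierstrassP_add_mem (z : ℂ) {l : ℂ} (hl : l ∈ L.lattice) :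
    L.derivWeierstrassP (z + l) = L.derivWeierstrassP z :=
  L.derivWeierstrassP_add_coe z ⟨l, hl⟩

theorem weierstrassP_eq_of_sub_mem {z w : ℂ} (h : z - w ∈ L.lattice) :
    L.weierstrassP z = L.weierstrassP w := by
  rw [← weierstrassP_add_mem w h, add_sub_cancel]

theorem weierstrassP_eq_of_add_mem {z w : ℂ} (h : z + w ∈ L.lattice) :
    L.weierstrassP z = L.weierstrassP w := by
  rw [← L.weierstrassP_neg w]
  exact weierstrassP_eq_of_sub_mem (by simpa using h)

theorem hasDerivAt_weierstrassP {z : ℂ} (hz : z ∉ L.lattice) :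
    HasDerivAt L.weierstrassP (L.derivWeierstrassP z) z := by
  rw [← L.deriv_weierstrassP]
  exact (L.analyticOnNhd_weierstrassP z hz).differentiableAt.hasDerivAt

theorem derivWeierstrassP_eq_zero_of_two_mul_mem {w : ℂ} (hw : 2 * w ∈ L.lattice) :
    L.derivWeierstrassP w = 0 := by
  rw [← CharZero.eq_neg_self_iff, ← L.derivWeierstrassP_neg,
    ← derivWeierstrassP_add_mem (-w) hw]
  ring_nf

theorem meromorphicOrderAt_weierstrassP_sub_const {z : ℂ} (hz : z ∈ L.lattice) (c : ℂ) :
    meromorphicOrderAt (fun x => L.weierstrassP x - c) z = -2 := by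
  rw [← L.order_weierstrassP z hz]
  simp_rw [sub_eq_add_neg]
  refine meromorphicOrderAt_add_eq_left_of_lt (f₂ := fun _ : ℂ => -c) (.const _ _) ?_
  rw [L.order_weierstrassP z hz]
  refine lt_of_lt_of_le ?_ (analyticAt_const (v := -c)).meromorphicOrderAt_nonneg
  exact WithTop.coe_lt_coe.2 (by norm_num : (-2 : ℤ) < 0)

theorem meromorphicAt_weierstrassP_sub_const (c z : ℂ) :
    MeromorphicAt (fun x => L.weierstrassP x - c) z :=
  (L.meromorphic_weierstrassP z).sub (.const c z)

theorem meromorphicOrderAt_weierstrassP_sub_const_ne_top (c z : ℂ) :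
    meromorphicOrderAt (fun x => L.weierstrassP x - c) z ≠ ⊤ := by
  refine MeromorphicOn.meromorphicOrderAt_ne_top_of_isPreconnected
    (U := Set.univ) (x := 0) (fun z _ => meromorphicAt_weierstrassP_sub_const c z)
    isPreconnected_univ (Set.mem_univ _) (Set.mem_univ _) ?_
  rw [meromorphicOrderAt_weierstrassP_sub_const (zero_mem _)]
  exact WithTop.coe_ne_top (a := (-2 : ℤ))

/-- `w` represents a point of order exactly two on `ℂ / Λ`. -/
structure IsHalfPeriod (L : PeriodPair) (w : ℂ) : Prop where
  notMem : w ∉ L.lattice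
  two_mul_mem : 2 * w ∈ L.lattice

theorem sub_mem_iff_add_mem {w : ℂ} (hw : 2 * w ∈ L.lattice) (z : ℂ) :
    z - w ∈ L.lattice ↔ z + w ∈ L.lattice := by
  rw [show z + w = z - w + 2 * w by ring]
  exact (L.lattice.toAddSubgroup.add_mem_cancel_right hw).symm

/-- At a lattice point the double pole of one factor meets a zero of the other, so at most a simple
pole remains, and evenness removes it. Translation by `w` swaps the factors, which settles the
points `-w + Λ`. Liouville's theorem then applies. -/
theorem exists_mul_weierstrassP_add_eq {w : ℂ} (hw : L.IsHalfPeriod w) :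
    ∃ K, ∀ z, z ∉ L.lattice → z + w ∉ L.lattice →
      (L.weierstrassP z - L.weierstrassP w) * (L.weierstrassP (z + w) - L.weierstrassP w) = K := by
  set e := L.weierstrassP w
  set F : ℂ → ℂ := fun z => (L.weierstrassP z - e) * (L.weierstrassP (z + w) - e) with hF
  have hper : ∀ l ∈ L.lattice, ∀ z, F (z + l) = F z := fun l hl z => by
    simp only [hF, weierstrassP_add_mem z hl, add_right_comm z l w, weierstrassP_add_mem (z + w) hl]
  have hperw : ∀ z, F (z + w) = F z := fun z => by
    simp only [hF]
    rw [add_assoc, ← two_mul, weierstrassP_add_mem z hw.two_mul_mem, mul_comm]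
  have hm2 : ∀ z, MeromorphicAt (fun z => L.weierstrassP (z + w) - e) z := fun z =>
    (meromorphicAt_weierstrassP_sub_const (L := L) e (z + w)).comp_analyticAt
      (g := fun z => z + w) (analyticAt_id.add analyticAt_const)
  have hmer : ∀ z, MeromorphicAt F z := fun z =>
    (meromorphicAt_weierstrassP_sub_const e z).mul (hm2 z)
  have han : ∀ z, z ∉ L.lattice → AnalyticAt ℂ (fun z => L.weierstrassP z - e) z :=
    fun z hz => (L.analyticOnNhd_weierstrassP z hz).sub analyticAt_const
  have han2 : ∀ z, z + w ∉ L.lattice → AnalyticAt ℂ (fun z => L.weierstrassP (z + w) - e) z :=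
    fun z hz => (han (z + w) hz).fun_comp (f := fun z => z + w) (analyticAt_id.add analyticAt_const)
  have hordΛ : ∀ z ∈ L.lattice, 0 ≤ meromorphicOrderAt F z := fun z hz => by
    have hzw : z + w ∉ L.lattice := fun h => hw.notMem (by simpa using sub_mem h hz)
    refine meromorphicOrderAt_nonneg_of_even (hmer z) ?_ fun x => ?_
    · have h1 : (0 : WithTop ℤ) < meromorphicOrderAt (fun z => L.weierstrassP (z + w) - e) z := by
        rw [← tendsto_zero_iff_meromorphicOrderAt_pos (hm2 z)]
        have := (han2 z hzw).continuousAt.tendsto.mono_left (nhdsWithin_le_nhds (s := {z}ᶜ))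
        simpa [add_comm z w, weierstrassP_add_mem w hz, e] using this
      have h2 := WithTop.add_one_le_of_lt_int (n := 0) (by exact_mod_cast h1)
      have h3 : meromorphicOrderAt F z = -2 + _ :=
        (meromorphicOrderAt_mul (meromorphicAt_weierstrassP_sub_const e z) (hm2 z)).trans
          (by rw [meromorphicOrderAt_weierstrassP_sub_const hz])
      rw [h3]
      calc ((-1 : ℤ) : WithTop ℤ) = -2 + ((0 + 1 : ℤ) : WithTop ℤ) := by norm_cast
        _ ≤ _ := by gcongr
    · have h2z : 2 * z ∈ L.lattice := by rw [two_mul]; exact add_mem hz hz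
      simp only [hF]
      rw [weierstrassP_eq_of_add_mem (z := 2 * z - x) (w := x) (by simpa using h2z),
        weierstrassP_eq_of_add_mem (z := 2 * z - x + w) (w := x + w)
          (by convert add_mem h2z hw.two_mul_mem using 1; ring)]
  have hord : ∀ z, 0 ≤ meromorphicOrderAt F z := fun z => by
    by_cases hz : z ∈ L.lattice
    · exact hordΛ z hz
    by_cases hzw : z + w ∈ L.lattice
    · have := hordΛ _ hzw
      rw [← meromorphicOrderAt_fun_comp_add_const_eq_meromorphicOrderAt] at this
      simpa only [hperw] using this
    · exact ((han z hz).mul (han2 z hzw)).meromorphicOrderAt_nonneg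
  obtain ⟨K, hK⟩ := L.eq_const_of_meromorphicOrderAt_nonneg hper hmer hord
  exact ⟨K, fun z hz hzw => hK z ((han z hz).mul (han2 z hzw))⟩

/-- Another solution would force the constant of `exists_mul_weierstrassP_add_eq` to be `0`, yet
neither factor vanishes identically near `0`. This replaces a count of the zeros of `℘ - ℘ w`. -/
theorem weierstrassP_eq_halfPeriod_iff {w : ℂ} (hw : L.IsHalfPeriod w) {z : ℂ}
    (hz : z ∉ L.lattice) :
    L.weierstrassP z = L.weierstrassP w ↔ z - w ∈ L.lattice := by
  refine ⟨fun h => ?_, weierstrassP_eq_of_sub_mem⟩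
  rw [sub_mem_iff_add_mem hw.two_mul_mem]
  by_contra hzw
  obtain ⟨K, hK⟩ := exists_mul_weierstrassP_add_eq hw
  obtain rfl : 0 = K := by rw [← hK z hz hzw, h, sub_self, zero_mul]
  have h1 := (meromorphicOrderAt_ne_top_iff_eventually_ne_zero
    (meromorphicAt_weierstrassP_sub_const _ 0)).1
    (meromorphicOrderAt_weierstrassP_sub_const_ne_top (L := L) (L.weierstrassP w) 0)
  have h2 := (meromorphicOrderAt_ne_top_iff_eventually_ne_zero
    (meromorphicAt_weierstrassP_sub_const _ (0 + w))).1
    (meromorphicOrderAt_weierstrassP_sub_const_ne_top (L := L) (L.weierstrassP w) (0 + w))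
  have hsh := tendsto_add_const_nhdsNE 0 w
  have h3 : ∀ᶠ x in 𝓝[≠] (0 : ℂ), x ∉ L.lattice := by
    filter_upwards [self_mem_nhdsWithin,
      mem_nhdsWithin_of_mem_nhds (L.compl_lattice_sdiff_singleton_mem_nhds 0)] with x hx0 hx hxl
    exact hx ⟨hxl, hx0⟩
  have h4 : ∀ᶠ x in 𝓝[≠] (0 : ℂ), x + w ∉ L.lattice := by
    have : (L.lattice : Set ℂ)ᶜ ∈ 𝓝 (0 + w) :=
      L.isClosed_lattice.isOpen_compl.mem_nhds (by simpa using hw.notMem)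
    exact hsh.eventually (mem_nhdsWithin_of_mem_nhds this)
  obtain ⟨x, hx1, hx2, hx3, hx4⟩ := (h1.and ((hsh.eventually h2).and (h3.and h4))).exists
  exact mul_ne_zero hx1 hx2 (hK x hx3 hx4)

/-- Three half periods that represent the three points of order two of `ℂ / Λ`. -/
structure IsHalfPeriodTriple (L : PeriodPair) (w u v : ℂ) : Prop where
  left : L.IsHalfPeriod w
  middle : L.IsHalfPeriod u
  right : L.IsHalfPeriod v
  total_mem : w + u + v ∈ L.lattice

namespace IsHalfPeriodTriple

variable {w u v : ℂ} (h : L.IsHalfPeriodTriple w u v)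
include h

theorem rotate : L.IsHalfPeriodTriple u v w :=
  ⟨h.middle, h.right, h.left, by convert h.total_mem using 1; ring⟩

theorem swap : L.IsHalfPeriodTriple w v u :=
  ⟨h.left, h.right, h.middle, by convert h.total_mem using 1; ring⟩

theorem add_notMem : w + u ∉ L.lattice := fun hm =>
  h.right.notMem (by simpa using sub_mem h.total_mem hm)

theorem weierstrassP_ne : L.weierstrassP w ≠ L.weierstrassP u := fun he =>
  h.add_notMem ((sub_mem_iff_add_mem h.middle.two_mul_mem w).1
    ((weierstrassP_eq_halfPeriod_iff h.middle h.left.notMem).1 he))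

/-- The constant is found by evaluating at `z = u`, where `u + w` is congruent to `-v`. -/
theorem mul_weierstrassP_add {z : ℂ} (hz : z ∉ L.lattice) (hzw : z + w ∉ L.lattice) :
    (L.weierstrassP z - L.weierstrassP w) * (L.weierstrassP (z + w) - L.weierstrassP w) =
      (L.weierstrassP u - L.weierstrassP w) * (L.weierstrassP v - L.weierstrassP w) := by
  obtain ⟨K, hK⟩ := exists_mul_weierstrassP_add_eq h.left
  rw [hK z hz hzw, ← hK u h.middle.notMem (by rw [add_comm]; exact h.add_notMem),
    weierstrassP_eq_of_add_mem (z := u + w) (w := v) (by rw [add_comm u]; exact h.total_mem)]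

theorem root : 4 * L.weierstrassP w ^ 3 - L.g₂ * L.weierstrassP w - L.g₃ = 0 := by
  rw [← L.derivWeierstrassP_sq w h.left.notMem,
    derivWeierstrassP_eq_zero_of_two_mul_mem h.left.two_mul_mem]
  ring

theorem weierstrassP_sum : L.weierstrassP w + L.weierstrassP u + L.weierstrassP v = 0 := by
  have h1 := h.root
  have h2 := h.rotate.root
  have h3 := h.rotate.rotate.root
  have n1 := sub_ne_zero.2 h.weierstrassP_ne
  have n2 := sub_ne_zero.2 h.rotate.weierstrassP_ne
  have n3 := sub_ne_zero.2 h.rotate.rotate.weierstrassP_ne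
  generalize L.weierstrassP w = a at *
  generalize L.weierstrassP u = b at *
  generalize L.weierstrassP v = c at *
  -- With weights `b - c`, `c - a`, `a - b` the terms in `g₂` and `g₃` cancel, which leaves an
  -- alternating quartic.
  have : (a - b) * (b - c) * (c - a) * (a + b + c) = 0 := by
    linear_combination -(b - c) / 4 * h1 - (c - a) / 4 * h2 - (a - b) / 4 * h3
  simpa [n1, n2, n3] using this

theorem derivWeierstrassP_sq_eq {z : ℂ} (hz : z ∉ L.lattice) :
    L.derivWeierstrassP z ^ 2 = 4 * (L.weierstrassP z - L.weierstrassP w) *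
      (L.weierstrassP z - L.weierstrassP u) * (L.weierstrassP z - L.weierstrassP v) := by
  rw [L.derivWeierstrassP_sq z hz]
  have h0 := h.weierstrassP_sum
  have h1 := h.root
  have h2 := h.rotate.root
  have n1 := sub_ne_zero.2 h.weierstrassP_ne
  generalize L.weierstrassP w = a at *
  generalize L.weierstrassP u = b at *
  have hv : L.weierstrassP v = -a - b := by linear_combination h0
  have hg2 : L.g₂ = 4 * (a ^ 2 + a * b + b ^ 2) := by
    refine mul_left_cancel₀ n1 ?_
    linear_combination h2 - h1
  have hg3 : L.g₃ = 4 * a ^ 3 - 4 * (a ^ 2 + a * b + b ^ 2) * a := by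
    rw [← hg2]; linear_combination -h1
  rw [hv, hg2, hg3]
  ring

theorem derivWeierstrassP_ne_zero {z : ℂ} (hz : 2 * z ∉ L.lattice) :
    L.derivWeierstrassP z ≠ 0 := fun h0 => by
  have hzl : z ∉ L.lattice := fun hm => hz (by rw [two_mul]; exact add_mem hm hm)
  have key : ∀ x : ℂ, L.IsHalfPeriod x → L.weierstrassP z - L.weierstrassP x ≠ 0 := by
    intro x hx he
    have := (weierstrassP_eq_halfPeriod_iff hx hzl).1 (sub_eq_zero.1 he)
    refine hz ?_
    convert add_mem (add_mem this this) hx.two_mul_mem using 1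
    ring
  have hsq := h.derivWeierstrassP_sq_eq hzl
  rw [h0] at hsq
  have := key w h.left
  have := key u h.middle
  have := key v h.right
  simp_all

/-- Differentiate the factored equation for `℘' ^ 2` and cancel `2 ℘'`, which is nonzero off the
`2`-torsion. -/
theorem hasDerivAt_derivWeierstrassP {z : ℂ} (hz : 2 * z ∉ L.lattice) :
    HasDerivAt L.derivWeierstrassP
      (2 * ((L.weierstrassP z - L.weierstrassP w) * (L.weierstrassP z - L.weierstrassP u) +
        (L.weierstrassP z - L.weierstrassP w) * (L.weierstrassP z - L.weierstrassP v) +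
        (L.weierstrassP z - L.weierstrassP u) * (L.weierstrassP z - L.weierstrassP v))) z := by
  have hzl : z ∉ L.lattice := fun hm => hz (by rw [two_mul]; exact add_mem hm hm)
  have hP := hasDerivAt_weierstrassP hzl
  have hd := (L.analyticOnNhd_derivWeierstrassP z hzl).differentiableAt.hasDerivAt
  have h1 := hd.pow 2
  have h2 := (((hP.sub_const (L.weierstrassP w)).const_mul 4).mul
    (hP.sub_const (L.weierstrassP u))).mul (hP.sub_const (L.weierstrassP v))
  have heq := h1.unique (h2.congr_of_eventuallyEq (by
    filter_upwards [L.isClosed_lattice.isOpen_compl.mem_nhds hzl] with x hx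
    exact h.derivWeierstrassP_sq_eq hx))
  have hne := h.derivWeierstrassP_ne_zero hz
  refine hd.congr_deriv ?_
  refine mul_left_cancel₀ (mul_ne_zero two_ne_zero hne) ?_
  simp only [Nat.cast_ofNat, Nat.add_one_sub_one, pow_one, Pi.mul_apply] at heq
  rw [heq]
  ring

/-- An odd elliptic function whose only possible poles are simple poles at the lattice points
vanishes. -/
theorem eq_zero_of_odd {F : ℂ → ℂ} (hodd : ∀ z, F (-z) = -F z)
    (hper : ∀ l ∈ L.lattice, ∀ z, F (z + l) = F z)
    (han : ∀ z, z ∉ L.lattice → AnalyticAt ℂ F z) (hmer : MeromorphicAt F 0)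
    (hord : ((-1 : ℤ) : WithTop ℤ) ≤ meromorphicOrderAt F 0) {z : ℂ} (hz : z ∉ L.lattice) :
    F z = 0 := by
  have hF2 : MeromorphicAt (fun z => F z ^ 2) 0 := hmer.pow 2
  have hord2 : ((-2 : ℤ) : WithTop ℤ) ≤ meromorphicOrderAt (fun z => F z ^ 2) 0 := by
    have : meromorphicOrderAt (fun z => F z ^ 2) 0 = _ := meromorphicOrderAt_pow hmer
    rw [this]
    cases hF : meromorphicOrderAt F 0 with
    | top => exact le_top
    | coe k =>
      rw [hF] at hord
      have : -1 ≤ k := by exact_mod_cast hord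
      exact WithTop.coe_le_coe.2 (show -2 ≤ 2 * k by omega)
  -- `F ^ 2 - a ℘` loses its double pole by the choice of `a` and its simple pole by evenness, so it
  -- is constant.
  obtain ⟨a, ha⟩ := exists_lt_meromorphicOrderAt_sub_smul hF2 (L.meromorphic_weierstrassP 0)
    (n := -2) (L.order_weierstrassP 0 (zero_mem _)) hord2
  set G : ℂ → ℂ := fun z => F z ^ 2 - a * L.weierstrassP z with hG
  have hGper : ∀ l ∈ L.lattice, ∀ z, G (z + l) = G z := fun l hl z => by
    simp only [hG, hper l hl z, weierstrassP_add_mem z hl]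
  have hG0 : MeromorphicAt G 0 := hF2.sub ((MeromorphicAt.const a 0).mul
    (L.meromorphic_weierstrassP 0))
  have hGo : 0 ≤ meromorphicOrderAt G 0 := by
    refine meromorphicOrderAt_nonneg_of_even hG0 (by simpa using ha) fun z => ?_
    simp only [hG, mul_zero, zero_sub, hodd, L.weierstrassP_neg]
    ring
  have hGa : ∀ z, z ∉ L.lattice → AnalyticAt ℂ G z := fun z hz =>
    ((han z hz).pow 2).sub (analyticAt_const.mul (L.analyticOnNhd_weierstrassP z hz))
  have hGl : ∀ l ∈ L.lattice, (fun z => G (z + -l)) = G := fun l hl =>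
    funext (hGper _ (neg_mem hl))
  obtain ⟨c, hc⟩ := L.eq_const_of_meromorphicOrderAt_nonneg hGper
    (fun z => by
      by_cases hz : z ∈ L.lattice
      · rw [← hGl z hz]
        exact MeromorphicAt.comp_analyticAt (f := G) (g := fun x => x + -z) (x := z)
          (by simpa using hG0) (analyticAt_id.add analyticAt_const)
      · exact (hGa z hz).meromorphicAt)
    (fun z => by
      by_cases hz : z ∈ L.lattice
      · rw [← hGl z hz, meromorphicOrderAt_fun_comp_add_const_eq_meromorphicOrderAt]
        simpa using hGo
      · exact (hGa z hz).meromorphicOrderAt_nonneg)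
  have hFhalf : ∀ x, L.IsHalfPeriod x → F x = 0 := fun x hx => by
    rw [← CharZero.eq_neg_self_iff, ← hodd, ← hper _ hx.two_mul_mem (-x)]
    ring_nf
  have h1 := hc w (hGa w h.left.notMem)
  have h2 := hc u (hGa u h.middle.notMem)
  simp only [hG, hFhalf w h.left, hFhalf u h.middle] at h1 h2
  -- Oddness makes `F` vanish at the half periods. The constant is therefore both `-a ℘ w` and `-a ℘
  -- u`, with `℘ w ≠ ℘ u`.
  have ha0 : a = 0 := by
    have : a * (L.weierstrassP w - L.weierstrassP u) = 0 := by linear_combination h2 - h1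
    simpa [sub_ne_zero.2 h.weierstrassP_ne] using this
  have h3 := hc z (hGa z hz)
  simp only [hG, ha0] at h3 h1
  have : F z ^ 2 = 0 := by linear_combination h3 - h1
  simpa using this

end IsHalfPeriodTriple

end PeriodPair

/-! ### The half logarithmic derivatives: poles, products, derivatives and translates -/

namespace PeriodPair

variable {L : PeriodPair}

/-- Half the logarithmic derivative of `℘ - ℘ w`.  If `w` is a half period, this is an odd elliptic
function with simple poles at `0` and `w`. -/
noncomputable def halfLogDeriv (L : PeriodPair) (w z : ℂ) : ℂ :=
  L.derivWeierstrassP z / (2 * (L.weierstrassP z - L.weierstrassP w))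

theorem halfLogDeriv_eq_logDeriv (w : ℂ) :
    L.halfLogDeriv w = (fun _ => (1 / 2 : ℂ)) *
      logDeriv (fun z => L.weierstrassP z - L.weierstrassP w) := by
  funext z
  simp only [halfLogDeriv, Pi.mul_apply, logDeriv_apply, deriv_sub_const, L.deriv_weierstrassP]
  rw [div_mul_div_comm, one_mul]

theorem halfLogDeriv_neg (w z : ℂ) : L.halfLogDeriv w (-z) = -L.halfLogDeriv w z := by
  simp only [halfLogDeriv, L.weierstrassP_neg, L.derivWeierstrassP_neg, neg_div]

theorem halfLogDeriv_add_mem (w z : ℂ) {l : ℂ} (hl : l ∈ L.lattice) :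
    L.halfLogDeriv w (z + l) = L.halfLogDeriv w z := by
  simp only [halfLogDeriv, weierstrassP_add_mem z hl, derivWeierstrassP_add_mem z hl]

theorem meromorphicAt_halfLogDeriv (w z : ℂ) : MeromorphicAt (L.halfLogDeriv w) z :=
  (L.meromorphic_derivWeierstrassP z).div
    ((MeromorphicAt.const 2 z).mul (meromorphicAt_weierstrassP_sub_const _ z))

theorem notMem_of_two_mul_notMem {z : ℂ} (hz : 2 * z ∉ L.lattice) : z ∉ L.lattice := fun hm =>
  hz (by rw [two_mul]; exact add_mem hm hm)

namespace IsHalfPeriod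

variable {w : ℂ} (hw : L.IsHalfPeriod w)
include hw

theorem weierstrassP_sub_ne_zero {z : ℂ} (hz : z ∉ L.lattice) (hzw : z - w ∉ L.lattice) :
    L.weierstrassP z - L.weierstrassP w ≠ 0 := fun h =>
  hzw ((weierstrassP_eq_halfPeriod_iff hw hz).1 (sub_eq_zero.1 h))

theorem sub_notMem {z : ℂ} (hz : 2 * z ∉ L.lattice) : z - w ∉ L.lattice := fun hm => hz (by
  convert add_mem (add_mem hm hm) hw.two_mul_mem using 1
  ring)

theorem weierstrassP_sub_ne_zero' {z : ℂ} (hz : 2 * z ∉ L.lattice) :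
    L.weierstrassP z - L.weierstrassP w ≠ 0 :=
  hw.weierstrassP_sub_ne_zero (notMem_of_two_mul_notMem hz) (hw.sub_notMem hz)

theorem analyticAt_halfLogDeriv {z : ℂ} (hz : z ∉ L.lattice) (hzw : z - w ∉ L.lattice) :
    AnalyticAt ℂ (L.halfLogDeriv w) z :=
  (L.analyticOnNhd_derivWeierstrassP z hz).div
    (analyticAt_const.mul ((L.analyticOnNhd_weierstrassP z hz).sub analyticAt_const))
    (mul_ne_zero two_ne_zero (hw.weierstrassP_sub_ne_zero hz hzw))

/-- A logarithmic derivative has a simple pole wherever the function has a zero or a pole. The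
multiplicity of the zero at `w` is not needed. -/
theorem meromorphicOrderAt_halfLogDeriv {z : ℂ} (hz : z ∈ L.lattice ∨ z - w ∈ L.lattice) :
    meromorphicOrderAt (L.halfLogDeriv w) z = ((-1 : ℤ) : WithTop ℤ) := by
  rw [halfLogDeriv_eq_logDeriv, meromorphicOrderAt_mul_of_ne_zero analyticAt_const (by norm_num),
    meromorphicOrderAt_logDeriv_eq_neg_one (meromorphicAt_weierstrassP_sub_const _ z) ?_
      (meromorphicOrderAt_weierstrassP_sub_const_ne_top _ z)]
  · rfl
  rcases hz with hz | hz
  · rw [meromorphicOrderAt_weierstrassP_sub_const hz]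
    exact fun h => absurd (WithTop.coe_injective (h : ((-2 : ℤ) : WithTop ℤ) = ((0 : ℤ) : WithTop ℤ)))
      (by norm_num)
  · have hzl : z ∉ L.lattice := fun hm => hw.notMem (by simpa using sub_mem hm hz)
    refine ne_of_gt ?_
    rw [← tendsto_zero_iff_meromorphicOrderAt_pos (meromorphicAt_weierstrassP_sub_const _ z)]
    have := ((L.analyticOnNhd_weierstrassP z hzl).continuousAt.sub_const
      (L.weierstrassP w)).mono_left (nhdsWithin_le_nhds (s := {z}ᶜ))
    simpa [weierstrassP_eq_of_sub_mem hz] using this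

theorem neg_one_le_meromorphicOrderAt_halfLogDeriv (z : ℂ) :
    ((-1 : ℤ) : WithTop ℤ) ≤ meromorphicOrderAt (L.halfLogDeriv w) z := by
  by_cases hz : z ∈ L.lattice ∨ z - w ∈ L.lattice
  · exact (hw.meromorphicOrderAt_halfLogDeriv hz).ge
  · rw [not_or] at hz
    exact le_trans (WithTop.coe_le_coe.2 (by norm_num : (-1 : ℤ) ≤ 0))
      (hw.analyticAt_halfLogDeriv hz.1 hz.2).meromorphicOrderAt_nonneg

end IsHalfPeriod

namespace IsHalfPeriodTriple

variable {w u v : ℂ} (h : L.IsHalfPeriodTriple w u v)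
include h

theorem sub_notMem : u - w ∉ L.lattice := fun hm =>
  h.add_notMem (by rw [add_comm]; exact (sub_mem_iff_add_mem h.left.two_mul_mem u).1 hm)

theorem halfLogDeriv_mul {z : ℂ} (hz : 2 * z ∉ L.lattice) :
    L.halfLogDeriv w z * L.halfLogDeriv u z = L.weierstrassP z - L.weierstrassP v := by
  have h1 := h.left.weierstrassP_sub_ne_zero' hz
  have h2 := h.middle.weierstrassP_sub_ne_zero' hz
  have h3 := h.derivWeierstrassP_sq_eq (notMem_of_two_mul_notMem hz)
  simp only [halfLogDeriv]
  field_simp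
  linear_combination h3

/-- This Riccati equation trades the square of a basis function for `℘`, a constant and an exact
term. The relation that the three half-period values sum to `0` gives the constant its short form.
-/
theorem hasDerivAt_halfLogDeriv {z : ℂ} (hz : 2 * z ∉ L.lattice) :
    HasDerivAt (L.halfLogDeriv w)
      (2 * L.weierstrassP z + L.weierstrassP w - L.halfLogDeriv w z ^ 2) z := by
  have h1 := h.left.weierstrassP_sub_ne_zero' hz
  have h3 := h.derivWeierstrassP_sq_eq (notMem_of_two_mul_notMem hz)
  have h0 := h.weierstrassP_sum
  have hP := hasDerivAt_weierstrassP (notMem_of_two_mul_notMem hz)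
  refine ((h.hasDerivAt_derivWeierstrassP hz).div
    ((hP.sub_const (L.weierstrassP w)).const_mul 2)
    (mul_ne_zero two_ne_zero h1)).congr_deriv ?_
  simp only [halfLogDeriv]
  have hv : L.weierstrassP v = -L.weierstrassP w - L.weierstrassP u := by linear_combination h0
  rw [hv] at h3 ⊢
  generalize L.weierstrassP z = p at *
  generalize L.weierstrassP w = a at *
  generalize L.weierstrassP u = b at *
  generalize L.derivWeierstrassP z = q at *
  field_simp
  linear_combination (-1) * h3

/-- The derivative of the constant product in `mul_weierstrassP_add`. -/
theorem derivWeierstrassP_add {z : ℂ} (hz : 2 * z ∉ L.lattice) :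
    L.derivWeierstrassP z * (L.weierstrassP (z + w) - L.weierstrassP w) +
      (L.weierstrassP z - L.weierstrassP w) * L.derivWeierstrassP (z + w) = 0 := by
  have hzl := notMem_of_two_mul_notMem hz
  have hzw : z + w ∉ L.lattice :=
    (sub_mem_iff_add_mem h.left.two_mul_mem z).not.1 (h.left.sub_notMem hz)
  have h1 := (hasDerivAt_weierstrassP hzl).sub_const (L.weierstrassP w)
  have h2 := ((hasDerivAt_weierstrassP hzw).comp_add_const z w).sub_const (L.weierstrassP w)
  refine (h1.mul h2).unique ((hasDerivAt_const z ((L.weierstrassP u - L.weierstrassP w) *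
    (L.weierstrassP v - L.weierstrassP w))).congr_of_eventuallyEq ?_)
  have hc : ContinuousAt (fun x => x + w) z := by fun_prop
  filter_upwards [L.isClosed_lattice.isOpen_compl.mem_nhds hzl,
    hc.eventually (L.isClosed_lattice.isOpen_compl.mem_nhds hzw)] with x hx hxw
  exact h.mul_weierstrassP_add hx hxw

theorem halfLogDeriv_add_self {z : ℂ} (hz : 2 * z ∉ L.lattice) :
    L.halfLogDeriv w (z + w) = -L.halfLogDeriv w z := by
  have hzw : 2 * (z + w) ∉ L.lattice := fun hm => hz (by
    convert sub_mem hm h.left.two_mul_mem using 1; ring)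
  have h1 := h.left.weierstrassP_sub_ne_zero' hz
  have h2 := h.left.weierstrassP_sub_ne_zero' hzw
  have h3 := h.derivWeierstrassP_add hz
  simp only [halfLogDeriv]
  field_simp
  linear_combination h3

/-- By `mul_weierstrassP_add`, `℘ (z + w) - ℘ u` is a constant times `(℘ z - ℘ v) / (℘ z - ℘ w)`.
The claim is half its logarithmic derivative. -/
theorem halfLogDeriv_add {z : ℂ} (hz : 2 * z ∉ L.lattice) :
    L.halfLogDeriv u (z + w) = L.halfLogDeriv v z - L.halfLogDeriv w z := by
  have hzw : 2 * (z + w) ∉ L.lattice := fun hm => hz (by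
    convert sub_mem hm h.left.two_mul_mem using 1; ring)
  have h1 := h.left.weierstrassP_sub_ne_zero' hz
  have h2 := h.middle.weierstrassP_sub_ne_zero' hzw
  have h4 := h.right.weierstrassP_sub_ne_zero' hz
  have h3 := h.derivWeierstrassP_add hz
  have h5 := h.mul_weierstrassP_add (notMem_of_two_mul_notMem hz) (notMem_of_two_mul_notMem hzw)
  have hab := sub_ne_zero.2 h.weierstrassP_ne
  simp only [halfLogDeriv]
  generalize L.weierstrassP z = p at *
  generalize L.weierstrassP (z + w) = p' at *
  generalize L.weierstrassP w = a at *
  generalize L.weierstrassP u = b at *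
  generalize L.weierstrassP v = c at *
  generalize L.derivWeierstrassP z = q at *
  generalize L.derivWeierstrassP (z + w) = q' at *
  have e1 : p' - b = (a - b) * (p - c) / (p - a) := by
    field_simp
    linear_combination h5
  have e2 : p' - a = (b - a) * (c - a) / (p - a) := by
    field_simp
    linear_combination h5
  have e3 : q' = -q * ((b - a) * (c - a) / (p - a)) / (p - a) := by
    rw [← e2]
    field_simp
    linear_combination h3
  rw [e1, e3]
  field_simp
  ring

end IsHalfPeriodTriple

end PeriodPair

namespace PeriodPair

variable {L : PeriodPair}

/-- Off the lattice `℘'` vanishes at such `z`, so one factor of `℘' ^ 2` does. -/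
theorem IsHalfPeriodTriple.mem_of_two_mul_mem {w u v : ℂ} (h : L.IsHalfPeriodTriple w u v) {z : ℂ}
    (hz : 2 * z ∈ L.lattice) :
    z ∈ L.lattice ∨ z - w ∈ L.lattice ∨ z - u ∈ L.lattice ∨ z - v ∈ L.lattice := by
  by_cases hzl : z ∈ L.lattice
  · exact Or.inl hzl
  have h1 := h.derivWeierstrassP_sq_eq hzl
  rw [derivWeierstrassP_eq_zero_of_two_mul_mem hz] at h1
  rw [← weierstrassP_eq_halfPeriod_iff h.left hzl, ← weierstrassP_eq_halfPeriod_iff h.middle hzl,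
    ← weierstrassP_eq_halfPeriod_iff h.right hzl]
  simpa [sub_eq_zero, hzl, or_assoc] using h1.symm

end PeriodPair

/-! ### A basis of `V` and its eigenbasis under translation -/

noncomputable section

namespace OddElliptic

open PeriodPair

variable {L : PeriodPair}

theorem mk_mem_twoTorsion {z : ℂ} :
    (Submodule.Quotient.mk z : Curve L) ∈ TwoTorsion L ↔ 2 * z ∈ L.lattice := by
  have : (Submodule.Quotient.mk z : Curve L) ∈ TwoTorsion L ↔
      (2 : ℤ) • (Submodule.Quotient.mk z : Curve L) = 0 := by simp
  rw [this, ← Submodule.Quotient.mk_smul, Submodule.Quotient.mk_eq_zero]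
  simp

/-- A function on `ℂ / Λ` from a `Λ`-periodic function on `ℂ`. -/
def descend (F : ℂ → ℂ) (hF : ∀ l ∈ L.lattice, ∀ z, F (z + l) = F z) : Curve L → ℂ :=
  Quotient.lift (s := L.lattice.quotientRel) F fun a b hab => by
    have : a - b ∈ L.lattice := (Submodule.quotientRel_def L.lattice).1 hab
    rw [← hF _ this b, add_sub_cancel]

theorem pull_injective {f g : Curve L → ℂ} (hfg : ∀ z, pull L f z = pull L g z) : f = g := by
  funext P
  obtain ⟨z, rfl⟩ := Submodule.Quotient.mk_surjective _ P
  exact hfg z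

theorem pull_add_mem (f : Curve L → ℂ) (z : ℂ) {l : ℂ} (hl : l ∈ L.lattice) :
    pull L f (z + l) = pull L f z := by
  simp only [pull]
  congr 1
  rw [Submodule.Quotient.eq]
  simpa using hl

theorem pull_neg (f : V L) (z : ℂ) : pull L f (-z) = -pull L f z :=
  f.2.1 (Submodule.Quotient.mk z)

theorem pull_of_two_mul_mem (f : V L) {z : ℂ} (hz : 2 * z ∈ L.lattice) : pull L f z = 0 := by
  rw [← CharZero.eq_neg_self_iff, ← pull_neg, ← pull_add_mem _ (-z) hz]
  ring_nf

/-- The element `(1/2) ℘' / (℘ - ℘ w)` of `V`, for a half period `w`. -/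
def halfLogDerivV {w : ℂ} (hw : L.IsHalfPeriod w) : V L :=
  ⟨descend (L.halfLogDeriv w) fun _ hl z => halfLogDeriv_add_mem w z hl, by
    refine ⟨fun P => ?_, fun z hz => ?_, fun z _ => ?_⟩
    · obtain ⟨z, rfl⟩ := Submodule.Quotient.mk_surjective _ P
      exact halfLogDeriv_neg w z
    · rw [mk_mem_twoTorsion] at hz
      exact hw.analyticAt_halfLogDeriv (notMem_of_two_mul_notMem hz) (hw.sub_notMem hz)
    · exact ⟨meromorphicAt_halfLogDeriv w z, hw.neg_one_le_meromorphicOrderAt_halfLogDeriv z⟩⟩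

variable {w u v : ℂ} (h : L.IsHalfPeriodTriple w u v)
include h

/-- Only the first of the three functions has a pole at `w`. Rotating the triple handles the other
coefficients. -/
theorem eq_zero_of_linear_relation {a b c : ℂ}
    (hz : ∀ z, a * L.halfLogDeriv w z + b * L.halfLogDeriv u z + c * L.halfLogDeriv v z = 0) :
    a = 0 := by
  by_contra ha
  have hcl : ∀ x, L.IsHalfPeriod x → w - x ∉ L.lattice → ∀ k : ℂ,
      AnalyticAt ℂ (fun z => k * L.halfLogDeriv x z) w := fun x hx hwx k =>
    analyticAt_const.mul (hx.analyticAt_halfLogDeriv h.left.notMem hwx)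
  have hu : w - u ∉ L.lattice := fun hm => h.sub_notMem (by simpa using neg_mem hm)
  have hv : w - v ∉ L.lattice := h.rotate.rotate.sub_notMem
  have han := (hcl u h.middle hu (-b / a)).add (hcl v h.right hv (-c / a))
  have heq : L.halfLogDeriv w =
      (fun z => -b / a * L.halfLogDeriv u z) + fun z => -c / a * L.halfLogDeriv v z := by
    funext z
    simp only [Pi.add_apply]
    field_simp
    linear_combination hz z
  rw [← heq] at han
  have := han.meromorphicOrderAt_nonneg
  rw [h.left.meromorphicOrderAt_halfLogDeriv (Or.inr (by simp))] at this
  exact absurd (WithTop.coe_le_coe.1 this) (by norm_num)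

theorem exists_eq_linear_combination (f : V L) :
    ∃ a b c : ℂ, ∀ z, pull L f z =
      a * L.halfLogDeriv w z + b * L.halfLogDeriv u z + c * L.halfLogDeriv v z := by
  have hfm : ∀ z, 2 * z ∈ L.lattice → MeromorphicAt (pull L f) z ∧
      ((-1 : ℤ) : WithTop ℤ) ≤ meromorphicOrderAt (pull L f) z := fun z hz =>
    f.2.2.2 z (mk_mem_twoTorsion.2 hz)
  have hex : ∀ x, L.IsHalfPeriod x → ∃ a : ℂ, 0 ≤ meromorphicOrderAt
      (fun z => pull L f z - a * L.halfLogDeriv x z) x := fun x hx => by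
    obtain ⟨a, ha⟩ := exists_lt_meromorphicOrderAt_sub_smul (n := -1) (hfm x hx.two_mul_mem).1
      (meromorphicAt_halfLogDeriv x x) (hx.meromorphicOrderAt_halfLogDeriv (Or.inr (by simp)))
      (hfm x hx.two_mul_mem).2
    exact ⟨a, by simpa using ha⟩
  obtain ⟨a, ha⟩ := hex w h.left
  obtain ⟨b, hb⟩ := hex u h.middle
  obtain ⟨c, hc⟩ := hex v h.right
  refine ⟨a, b, c, ?_⟩
  set g : V L := f - a • halfLogDerivV h.left - b • halfLogDerivV h.middle -
    c • halfLogDerivV h.right with hg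
  have hgz : ∀ z, pull L g z = pull L f z - a * L.halfLogDeriv w z - b * L.halfLogDeriv u z -
    c * L.halfLogDeriv v z := fun z => rfl
  -- At the half period `x` only one subtracted term is singular, and it cancels the pole of `f`.
  -- Stated for a general triple, this serves all three half periods by rotation.
  have hpole : ∀ {x y t : ℂ} {p q r : ℂ} (_ : L.IsHalfPeriodTriple x y t)
      (_ : 0 ≤ meromorphicOrderAt (fun z => pull L f z - p * L.halfLogDeriv x z) x)
      (_ : ∀ z, pull L g z = pull L f z - p * L.halfLogDeriv x z + (-q * L.halfLogDeriv y z +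
        -r * L.halfLogDeriv t z)) (z : ℂ), z - x ∈ L.lattice → AnalyticAt ℂ (pull L g) z := by
    intro x y t p q r hT hp hgx z hz
    have hcl : ∀ s, L.IsHalfPeriod s → x - s ∉ L.lattice → ∀ k : ℂ,
        AnalyticAt ℂ (fun z => k * L.halfLogDeriv s z) x := fun s hs hxs k =>
      analyticAt_const.mul (hs.analyticAt_halfLogDeriv hT.left.notMem hxs)
    have hy : x - y ∉ L.lattice := fun hm => hT.sub_notMem (by simpa using neg_mem hm)
    have ht : x - t ∉ L.lattice := hT.rotate.rotate.sub_notMem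
    have hA := (hcl y hT.middle hy (-q)).add (hcl t hT.right ht (-r))
    have hm1 : MeromorphicAt (fun z => pull L f z - p * L.halfLogDeriv x z) x :=
      (hfm x hT.left.two_mul_mem).1.sub
        ((MeromorphicAt.const p x).mul (meromorphicAt_halfLogDeriv x x))
    have hgx' : pull L g = (fun z => pull L f z - p * L.halfLogDeriv x z) +
      ((fun z => -q * L.halfLogDeriv y z) + fun z => -r * L.halfLogDeriv t z) := funext hgx
    have hx : AnalyticAt ℂ (pull L g) x := by
      refine analyticAt_of_odd (g.2.2.2 x (mk_mem_twoTorsion.2 hT.left.two_mul_mem)).1 ?_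
        fun z => ?_
      · rw [hgx']
        exact (le_min hp hA.meromorphicOrderAt_nonneg).trans
          (meromorphicOrderAt_add hm1 hA.meromorphicAt)
      · rw [← pull_neg, sub_eq_neg_add, pull_add_mem _ _ hT.left.two_mul_mem]
    have hshift : (fun s => pull L g (s + -(z - x))) = pull L g :=
      funext fun s => pull_add_mem _ _ (neg_mem hz)
    rw [← hshift]
    exact AnalyticAt.fun_comp (g := pull L g) (f := fun s => s + -(z - x)) (by simpa using hx)
      (analyticAt_id.add analyticAt_const)
  have han : ∀ z, z ∉ L.lattice → AnalyticAt ℂ (pull L g) z := fun z hz => by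
    by_cases hz2 : 2 * z ∈ L.lattice
    · rcases h.mem_of_two_mul_mem hz2 with hm | hm | hm | hm
      · exact absurd hm hz
      · exact hpole (q := b) (r := c) h ha (fun z => by rw [hgz]; ring) z hm
      · exact hpole (q := c) (r := a) h.rotate hb (fun z => by rw [hgz]; ring) z hm
      · exact hpole (q := a) (r := b) h.rotate.rotate hc (fun z => by rw [hgz]; ring) z hm
    · exact g.2.2.1 z (mk_mem_twoTorsion.not.2 hz2)
  have h0 := g.2.2.2 0 (mk_mem_twoTorsion.2 (by simp))
  intro z
  have hgz0 : pull L g z = 0 := by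
    by_cases hz : z ∈ L.lattice
    · exact pull_of_two_mul_mem g (by rw [two_mul]; exact add_mem hz hz)
    · exact h.eq_zero_of_odd (pull_neg g) (fun l hl z => pull_add_mem _ z hl) han h0.1 h0.2 hz
  rw [hgz] at hgz0
  linear_combination hgz0

/-- The eigenbasis of the action of the `2`-torsion points on `V`: the function with label `i` is
invariant under the `i`-th half period and anti-invariant under the other two. -/
def eigenfunction : Fin 3 → V L :=
  ![halfLogDerivV h.left - halfLogDerivV h.middle - halfLogDerivV h.right,
    halfLogDerivV h.middle - halfLogDerivV h.right - halfLogDerivV h.left,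
    halfLogDerivV h.right - halfLogDerivV h.left - halfLogDerivV h.middle]

/-- The element of `V` with given coordinates in the eigenbasis. -/
def ofCoords : (Fin 3 → ℂ) →ₗ[ℂ] V L := Fintype.linearCombination ℂ (eigenfunction h)

theorem pull_ofCoords (c : Fin 3 → ℂ) (z : ℂ) :
    pull L (ofCoords h c) z = (c 0 - c 1 - c 2) * L.halfLogDeriv w z +
      (c 1 - c 2 - c 0) * L.halfLogDeriv u z + (c 2 - c 0 - c 1) * L.halfLogDeriv v z := by
  have : ofCoords h c = c 0 • eigenfunction h 0 + c 1 • eigenfunction h 1 +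
      c 2 • eigenfunction h 2 := by
    simp [ofCoords, Fintype.linearCombination_apply, Fin.sum_univ_three]
  rw [this]
  change c 0 * (L.halfLogDeriv w z - L.halfLogDeriv u z - L.halfLogDeriv v z) +
    c 1 * (L.halfLogDeriv u z - L.halfLogDeriv v z - L.halfLogDeriv w z) +
    c 2 * (L.halfLogDeriv v z - L.halfLogDeriv w z - L.halfLogDeriv u z) = _
  ring

theorem ofCoords_bijective : Function.Bijective (ofCoords h) := by
  constructor
  · rw [injective_iff_map_eq_zero]
    intro c hc
    have h0 : ∀ z, pull L (ofCoords h c) z = 0 := fun z => by rw [hc]; rfl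
    simp only [pull_ofCoords] at h0
    have h1 := eq_zero_of_linear_relation h h0
    have h2 := eq_zero_of_linear_relation h.rotate (a := c 1 - c 2 - c 0) (b := c 2 - c 0 - c 1)
      (c := c 0 - c 1 - c 2) fun z => by rw [← h0 z]; ring
    have h3 := eq_zero_of_linear_relation h.rotate.rotate (a := c 2 - c 0 - c 1)
      (b := c 0 - c 1 - c 2) (c := c 1 - c 2 - c 0) fun z => by rw [← h0 z]; ring
    funext i
    fin_cases i
    · change c 0 = 0
      -- Two of the three coefficients in `pull_ofCoords` add up to `-2` times one coordinate. The
      -- preimage given below for surjectivity comes from the same inversion.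
      linear_combination (-1 / 2 : ℂ) * (h2 + h3)
    · change c 1 = 0
      linear_combination (-1 / 2 : ℂ) * (h1 + h3)
    · change c 2 = 0
      linear_combination (-1 / 2 : ℂ) * (h1 + h2)
  · intro f
    obtain ⟨a, b, c, habc⟩ := exists_eq_linear_combination h f
    refine ⟨![-(b + c) / 2, -(a + c) / 2, -(a + b) / 2], Subtype.ext (pull_injective fun z => ?_)⟩
    rw [pull_ofCoords, habc]
    simp
    ring

/-- The coordinates on `V` with respect to the eigenbasis. -/
def coordsEquiv : (Fin 3 → ℂ) ≃ₗ[ℂ] V L := LinearEquiv.ofBijective _ (ofCoords_bijective h)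

theorem finrank_V : Module.finrank ℂ (V L) = 3 := by
  rw [← (coordsEquiv h).finrank_eq]
  simp

end OddElliptic

end

/-! ### The Weierstrass `ζ` function and the periods of `℘ dz` and `dz` -/

namespace PeriodPair

section Zeta

variable (L : PeriodPair)

/-- The summand collapses to `s ^ 2 / (l ^ 2 * (s - l))`, and cubic decay is summable over a lattice
in the plane. -/
theorem norm_weierstrassZeta_summand_le {r : ℝ} (hr : 0 < r) {s : ℂ} (hs : ‖s‖ < r) {l : ℂ}
    (h : 2 * r ≤ ‖l‖) :
    ‖1 / (s - l) + 1 / l + s / l ^ 2‖ ≤ 2 * r ^ 2 * ‖l‖ ^ (-3 : ℝ) := by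
  have hsl : s - l ≠ 0 := fun he => by
    obtain rfl := sub_eq_zero.1 he
    linarith
  have hl : 0 < ‖l‖ := by linarith
  have hl0 : l ≠ 0 := norm_pos_iff.1 hl
  have hd : ‖l‖ / 2 ≤ ‖s - l‖ := by
    rw [norm_sub_rev]
    exact le_trans (by linarith) (norm_sub_norm_le l s)
  calc ‖1 / (s - l) + 1 / l + s / l ^ 2‖ = ‖s ^ 2 / (l ^ 2 * (s - l))‖ := by
        congr 1
        field_simp
        ring
    _ = ‖s‖ ^ 2 / (‖l‖ ^ 2 * ‖s - l‖) := by simp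
    _ ≤ r ^ 2 / (‖l‖ ^ 2 * (‖l‖ / 2)) := by gcongr
    _ = 2 * r ^ 2 / ‖l‖ ^ 3 := by field_simp
    _ = _ := by norm_cast

/-- The Weierstrass `ζ` function without its principal part `1 / z` at the origin. -/
noncomputable def weierstrassZetaExcept (z : ℂ) : ℂ :=
  ∑' l : L.lattice, if l.1 = 0 then 0 else (1 / (z - l) + 1 / l + z / l ^ 2)

theorem hasSumLocallyUniformly_weierstrassZetaExcept :
    HasSumLocallyUniformly (fun (l : L.lattice) (z : ℂ) =>
      if l.1 = 0 then 0 else (1 / (z - l) + 1 / l + z / l ^ 2)) L.weierstrassZetaExcept := by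
  refine L.hasSumLocallyUniformly_aux (u := fun r l => 2 * r ^ 2 * ‖l‖ ^ (-3 : ℝ)) _
    (fun _ _ => (ZLattice.summable_norm_rpow _ _ (by simp; norm_num)).mul_left _) fun r hr =>
    Filter.eventually_atTop.mpr ⟨2 * r, ?_⟩
  rintro _ h s hs l rfl
  split_ifs
  · rw [norm_zero]
    positivity
  · exact norm_weierstrassZeta_summand_le hr hs h

theorem weierstrassZetaExcept_neg (z : ℂ) :
    L.weierstrassZetaExcept (-z) = -L.weierstrassZetaExcept z := by
  simp only [weierstrassZetaExcept]
  rw [← (Equiv.neg L.lattice).tsum_eq, ← tsum_neg]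
  refine tsum_congr fun l => ?_
  simp only [Equiv.neg_apply, NegMemClass.coe_neg, neg_eq_zero]
  split_ifs
  · simp
  · rw [show -z - -(l : ℂ) = -(z - l) by ring, div_neg, div_neg, neg_sq, neg_div]
    ring

theorem hasDerivAt_weierstrassZetaExcept {z : ℂ} (hz : z ∈ ((L.lattice : Set ℂ) \ {0})ᶜ) :
    HasDerivAt L.weierstrassZetaExcept (-L.weierstrassPExcept 0 z) z := by
  have hterm : ∀ l : L.lattice, ∀ x ∈ ((L.lattice : Set ℂ) \ {0})ᶜ,
      HasDerivAt (fun z : ℂ => if l.1 = 0 then 0 else (1 / (z - l) + 1 / l + z / l ^ 2))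
        (-if l.1 = 0 then 0 else (1 / (x - l) ^ 2 - 1 / l ^ 2)) x := fun l x hx => by
    split_ifs with hl
    · rw [neg_zero]
      exact hasDerivAt_const _ _
    · have hxl : x - l ≠ 0 := fun he => hx (by
        obtain rfl := sub_eq_zero.1 he
        exact ⟨l.2, hl⟩)
      refine ((((hasDerivAt_const x (1 : ℂ)).div ((hasDerivAt_id x).sub_const (l : ℂ)) hxl).add_const
        (1 / (l : ℂ))).add ((hasDerivAt_id x).div_const ((l : ℂ) ^ 2))).congr_deriv ?_
      simp only [id]
      ring
  have hopen := L.isOpen_compl_lattice_sdiff (s := {0})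
  refine hasDerivAt_of_tendstoLocallyUniformlyOn (l := atTop) hopen
    (f := fun (s : Finset L.lattice) (z : ℂ) =>
      ∑ l ∈ s, if l.1 = 0 then 0 else (1 / (z - l.1) + 1 / l.1 + z / l.1 ^ 2))
    (f' := fun (s : Finset L.lattice) (z : ℂ) =>
      ∑ l ∈ s, -if l.1 = 0 then 0 else (1 / (z - l.1) ^ 2 - 1 / l.1 ^ 2))
    (g := L.weierstrassZetaExcept) (g' := fun z => -L.weierstrassPExcept 0 z) ?_ ?_ ?_ hz
  · have := (L.hasSumLocallyUniformly_weierstrassPExcept 0).tendstoLocallyUniformlyOn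
      (s := ((L.lattice : Set ℂ) \ {0})ᶜ)
    simpa only [Finset.sum_neg_distrib] using! this.neg
  · exact Eventually.of_forall fun s x hx => HasDerivAt.fun_sum fun l _ => hterm l x hx
  · intro x hx
    exact L.hasSumLocallyUniformly_weierstrassZetaExcept.hasSum

end Zeta

variable {L : PeriodPair}

/-- The coefficient of `b` is `1 / 2`, never an integer. So the integration paths avoid the
`2`-torsion. -/
theorem two_mul_add_notMem_of_indep {a b : ℂ} (hab : LinearIndependent ℝ ![a, b])
    (hL : ∀ z ∈ L.lattice, ∃ m n : ℤ, m * a + n * b = z) (t : ℝ) :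
    2 * (b / 4 + t * a) ∉ L.lattice := fun hm => by
  obtain ⟨m, n, hmn⟩ := hL _ hm
  have h0 : ((2 * t - m : ℝ)) • a + ((1 / 2 - n : ℝ)) • b = 0 := by
    simp only [Complex.real_smul]
    push_cast
    linear_combination -hmn
  have h2 := (LinearIndependent.pair_iff.1 hab _ _ h0).2
  have h3 : (1 : ℝ) = 2 * n := by linarith
  have h4 : (1 : ℤ) = 2 * n := by exact_mod_cast h3
  omega

variable (L) in
theorem two_mul_path₁_notMem (t : ℝ) : 2 * (L.ω₂ / 4 + t * L.ω₁) ∉ L.lattice :=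
  two_mul_add_notMem_of_indep L.indep (fun _ hz => mem_lattice.1 hz) t

variable (L) in
theorem two_mul_path₂_notMem (t : ℝ) : 2 * (L.ω₁ / 4 + t * L.ω₂) ∉ L.lattice :=
  two_mul_add_notMem_of_indep (LinearIndependent.pair_symm_iff.1 L.indep) (fun z hz => by
    obtain ⟨m, n, hmn⟩ := mem_lattice.1 hz
    exact ⟨n, m, by rw [← hmn]; ring⟩) t

theorem integral_segment_eq_sub {G g : ℂ → ℂ} {z₀ ω : ℂ}
    (hG : ∀ t : ℝ, HasDerivAt G (g (z₀ + t * ω)) (z₀ + t * ω))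
    (hg : ∀ t : ℝ, ContinuousAt g (z₀ + t * ω)) :
    ∫ t in (0 : ℝ)..1, g (z₀ + t * ω) * ω = G (z₀ + ω) - G z₀ := by
  have hγ : ∀ t : ℝ, HasDerivAt (fun t : ℝ => z₀ + t * ω) ω t := fun t => by
    simpa using ((Complex.ofRealCLM.hasDerivAt (x := t)).mul_const ω).const_add z₀
  have hc : Continuous fun t : ℝ => g (z₀ + t * ω) * ω := by
    refine Continuous.mul ?_ continuous_const
    exact continuous_iff_continuousAt.2 fun t =>
      ContinuousAt.comp (f := fun t : ℝ => z₀ + t * ω) (hg t) (hγ t).continuousAt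
  have := intervalIntegral.integral_eq_sub_of_hasDerivAt (a := 0) (b := 1)
    (f := fun t : ℝ => G (z₀ + t * ω)) (f' := fun t : ℝ => g (z₀ + t * ω) * ω)
    (fun t _ => (hG t).comp t (hγ t)) (hc.intervalIntegrable 0 1)
  simpa using this

theorem countable_lattice : (L.lattice : Set ℂ).Countable := by
  have : Countable L.lattice := L.latticeEquivProd.toEquiv.countable_iff.2 inferInstance
  exact Set.to_countable _

theorem isPreconnected_compl_lattice : IsPreconnected (L.lattice : Set ℂ)ᶜ :=
  (Set.Countable.isPathConnected_compl_of_one_lt_rank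
    (by rw [Complex.rank_real_complex]; norm_num) countable_lattice).isConnected.isPreconnected

/-- The classes of `℘ dz` and `dz` in the first cohomology of `ℂ / Λ` are linearly independent. -/
theorem IsHalfPeriodTriple.eq_zero_of_periods_eq_zero {w u v : ℂ}
    (h : L.IsHalfPeriodTriple w u v) {S T : ℂ}
    (h₁ : ∫ t in (0 : ℝ)..1, (S * L.weierstrassP (L.ω₂ / 4 + t * L.ω₁) + T) * L.ω₁ = 0)
    (h₂ : ∫ t in (0 : ℝ)..1, (S * L.weierstrassP (L.ω₁ / 4 + t * L.ω₂) + T) * L.ω₂ = 0) :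
    S = 0 ∧ T = 0 := by
  classical
  -- `H = -S ζ + T z` is a primitive of `S ℘ + T`. If its two periods vanish, it is an odd elliptic
  -- function with at most simple poles on the lattice, hence `0`.
  set H : ℂ → ℂ := fun z => -S * (L.weierstrassZetaExcept z + z⁻¹) + T * z with hH
  have hd : ∀ z, z ∉ L.lattice → HasDerivAt H (S * L.weierstrassP z + T) z := fun z hz => by
    have hz0 : z ≠ 0 := fun h0 => hz (h0 ▸ zero_mem _)
    refine ((((L.hasDerivAt_weierstrassZetaExcept fun hm => hz hm.1).add
      (hasDerivAt_inv hz0)).const_mul (-S)).add ((hasDerivAt_id z).const_mul T)).congr_deriv ?_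
    rw [← L.weierstrassPExcept_add 0 z]
    simp only [ZeroMemClass.coe_zero, sub_zero]
    ring
  have hcont : ∀ z, z ∉ L.lattice → ContinuousAt (fun z => S * L.weierstrassP z + T) z :=
    fun z hz => ((L.analyticOnNhd_weierstrassP z hz).continuousAt.const_mul S).add_const T
  have hstep : ∀ z₀ ω : ℂ, ω ∈ L.lattice → (∀ t : ℝ, 2 * (z₀ + t * ω) ∉ L.lattice) →
      ∫ t in (0 : ℝ)..1, (S * L.weierstrassP (z₀ + t * ω) + T) * ω = 0 →
      ∀ z, z ∉ L.lattice → H (z + ω) = H z := by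
    intro z₀ ω hω hpath hint z hz
    have hp : ∀ t : ℝ, z₀ + t * ω ∉ L.lattice := fun t => notMem_of_two_mul_notMem (hpath t)
    have hz₀ : z₀ ∉ L.lattice := by simpa using hp 0
    rw [integral_segment_eq_sub (G := H) (g := fun z => S * L.weierstrassP z + T)
      (fun t => hd _ (hp t)) (fun t => hcont _ (hp t))] at hint
    have hdd : ∀ x ∈ (L.lattice : Set ℂ)ᶜ, HasDerivAt (fun x => H (x + ω) - H x) 0 x :=
      fun x hx => by
        have hxω : x + ω ∉ L.lattice := fun hm => hx (by simpa using sub_mem hm hω)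
        refine (((hd _ hxω).comp_add_const x ω).sub (hd x hx)).congr_deriv ?_
        rw [weierstrassP_add_mem x hω, sub_self]
    -- `H (x + ω) - H x` is constant on the connected complement of the lattice, and the integral
    -- gives its value at `z₀`.
    obtain ⟨c, hc⟩ := L.isClosed_lattice.isOpen_compl.exists_is_const_of_deriv_eq_zero
      isPreconnected_compl_lattice
      (fun x hx => (hdd x hx).differentiableAt.differentiableWithinAt) fun x hx => (hdd x hx).deriv
    have e1 := hc z₀ hz₀
    have e2 := hc z hz
    linear_combination e2 - e1 + hint
  -- The value `0` on the lattice makes periodicity and oddness hold at every point, as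
  -- `eq_zero_of_odd` demands.
  set F : ℂ → ℂ := fun z => if z ∈ L.lattice then 0 else H z with hF
  have hFH : ∀ z, z ∉ L.lattice → F z = H z := fun z hz => if_neg hz
  have hper : ∀ l ∈ L.lattice, ∀ z, F (z + l) = F z := by
    intro l hl
    refine Submodule.span_induction (p := fun l _ => ∀ z, F (z + l) = F z) ?_ ?_ ?_ ?_ hl
    · intro ω hω z
      have hωL : ω ∈ L.lattice := Submodule.subset_span hω
      by_cases hz : z ∈ L.lattice
      · simp only [hF, hz, add_mem hz hωL, if_true]
      have hzω : z + ω ∉ L.lattice := fun hm => hz (by simpa using sub_mem hm hωL)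
      rw [hFH _ hz, hFH _ hzω]
      rcases hω with rfl | rfl
      · exact hstep _ _ hωL L.two_mul_path₁_notMem h₁ z hz
      · exact hstep _ _ hωL L.two_mul_path₂_notMem h₂ z hz
    · simp
    · intro x y _ _ hx hy z
      rw [← add_assoc, hy, hx]
    · intro n x _ hx z
      induction n using Int.induction_on with
      | zero => simp
      | succ k ih => rw [add_smul, one_smul, ← add_assoc, hx, ih]
      | pred k ih =>
        rw [← hx (z + ((-(k : ℤ) - 1) • x)), ← ih, sub_smul, one_smul]
        congr 1
        abel
  have hodd : ∀ z, F (-z) = -F z := fun z => by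
    by_cases hz : z ∈ L.lattice
    · simp only [hF, neg_mem hz, hz, if_true, neg_zero]
    · rw [hFH _ hz, hFH _ (fun hm => hz (by simpa using neg_mem hm))]
      simp only [hH, L.weierstrassZetaExcept_neg, inv_neg]
      ring
  have hopen := L.isClosed_lattice.isOpen_compl
  have han : ∀ z, z ∉ L.lattice → AnalyticAt ℂ F z := fun z hz => by
    have : DifferentiableOn ℂ F (L.lattice : Set ℂ)ᶜ := fun x hx =>
      ((hd x hx).differentiableAt.differentiableWithinAt).congr (fun y hy => hFH y hy) (hFH x hx)
    exact this.analyticAt (hopen.mem_nhds hz)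
  have hZ : AnalyticAt ℂ L.weierstrassZetaExcept 0 := by
    have : DifferentiableOn ℂ L.weierstrassZetaExcept ((L.lattice : Set ℂ) \ {0})ᶜ := fun x hx =>
      (L.hasDerivAt_weierstrassZetaExcept hx).differentiableAt.differentiableWithinAt
    exact this.analyticAt (L.compl_lattice_sdiff_singleton_mem_nhds 0)
  have hA : AnalyticAt ℂ (fun z => -S * L.weierstrassZetaExcept z + T * z) 0 := by fun_prop
  have hB : MeromorphicAt (fun z : ℂ => -S * z⁻¹) 0 := by fun_prop
  have hBo : ((-1 : ℤ) : WithTop ℤ) ≤ meromorphicOrderAt (fun z : ℂ => -S * z⁻¹) 0 := by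
    have hinv : meromorphicOrderAt (fun z : ℂ => z⁻¹) 0 = ((-1 : ℤ) : WithTop ℤ) := by
      have := meromorphicOrderAt_inv (f := (id : ℂ → ℂ)) (x := 0)
      rw [meromorphicOrderAt_id] at this
      exact this
    rw [show meromorphicOrderAt (fun z : ℂ => -S * z⁻¹) 0 = _ from
      meromorphicOrderAt_mul (MeromorphicAt.const (-S) 0) (by fun_prop), hinv]
    exact le_add_of_nonneg_left (analyticAt_const (v := -S)).meromorphicOrderAt_nonneg
  have hev : F =ᶠ[𝓝[≠] 0] (fun z => -S * L.weierstrassZetaExcept z + T * z) +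
      fun z => -S * z⁻¹ := by
    filter_upwards [self_mem_nhdsWithin,
      mem_nhdsWithin_of_mem_nhds (L.compl_lattice_sdiff_singleton_mem_nhds 0)] with x hx0 hx
    rw [hFH x fun hxl => hx ⟨hxl, hx0⟩]
    simp only [hH, Pi.add_apply]
    ring
  have hmer : MeromorphicAt F 0 := (hA.meromorphicAt.add hB).congr hev.symm
  have hord : ((-1 : ℤ) : WithTop ℤ) ≤ meromorphicOrderAt F 0 := by
    rw [meromorphicOrderAt_congr hev]
    refine (le_min ?_ hBo).trans (meromorphicOrderAt_add hA.meromorphicAt hB)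
    exact le_trans (WithTop.coe_le_coe.2 (by norm_num : (-1 : ℤ) ≤ 0)) hA.meromorphicOrderAt_nonneg
  have hzero : ∀ z, z ∉ L.lattice → S * L.weierstrassP z + T = 0 := fun z hz =>
    (hd z hz).unique ((hasDerivAt_const z (0 : ℂ)).congr_of_eventuallyEq (by
      filter_upwards [hopen.mem_nhds hz] with x hx
      rw [← hFH x hx, h.eq_zero_of_odd hodd hper han hmer hord hx]))
  have e1 := hzero w h.left.notMem
  have e2 := hzero u h.middle.notMem
  have hS : S = 0 := by
    have : S * (L.weierstrassP w - L.weierstrassP u) = 0 := by linear_combination e1 - e2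
    simpa [sub_ne_zero.2 h.weierstrassP_ne] using this
  refine ⟨hS, ?_⟩
  simpa [hS] using e1

end PeriodPair

/-! ### The class of `f ^ 2 dz` in the eigenbasis -/

noncomputable section

namespace OddElliptic

open PeriodPair

variable {L : PeriodPair} {w u v : ℂ} (h : L.IsHalfPeriodTriple w u v)

/-- Expand the square, use `halfLogDeriv_mul` for the mixed products and `hasDerivAt_halfLogDeriv`
for the squares. The eigenbasis diagonalizes both resulting quadratic forms, because translation
does not change the class of `f ^ 2 dz`. -/
theorem hasDerivAt_pull_ofCoords_sq (c : Fin 3 → ℂ) : ∃ k : V L, ∀ z, 2 * z ∉ L.lattice →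
    HasDerivAt (pull L k) (pull L (ofCoords h c) z ^ 2 -
      (4 * (c 0 ^ 2 + c 1 ^ 2 + c 2 ^ 2) * L.weierstrassP z + -4 * (L.weierstrassP w * c 0 ^ 2 +
        L.weierstrassP u * c 1 ^ 2 + L.weierstrassP v * c 2 ^ 2))) z := by
  refine ⟨-((c 0 - c 1 - c 2) ^ 2 • halfLogDerivV h.left +
    (c 1 - c 2 - c 0) ^ 2 • halfLogDerivV h.middle +
    (c 2 - c 0 - c 1) ^ 2 • halfLogDerivV h.right), fun z hz => ?_⟩
  have h1 := (h.hasDerivAt_halfLogDeriv hz).const_mul ((c 0 - c 1 - c 2) ^ 2)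
  have h2 := (h.rotate.hasDerivAt_halfLogDeriv hz).const_mul ((c 1 - c 2 - c 0) ^ 2)
  have h3 := (h.rotate.rotate.hasDerivAt_halfLogDeriv hz).const_mul ((c 2 - c 0 - c 1) ^ 2)
  refine HasDerivAt.congr_deriv (f := pull L _) (((h1.add h2).add h3).neg) ?_
  have m1 := h.halfLogDeriv_mul hz
  have m2 := h.rotate.halfLogDeriv_mul hz
  have m3 := h.rotate.rotate.halfLogDeriv_mul hz
  have h0 := h.weierstrassP_sum
  rw [pull_ofCoords]
  linear_combination (-2 * (c 0 - c 1 - c 2) * (c 1 - c 2 - c 0)) * m1 -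
    2 * (c 1 - c 2 - c 0) * (c 2 - c 0 - c 1) * m2 -
    2 * (c 2 - c 0 - c 1) * (c 0 - c 1 - c 2) * m3 -
    (3 * (c 0 ^ 2 + c 1 ^ 2 + c 2 ^ 2) - 2 * (c 0 * c 1 + c 1 * c 2 + c 2 * c 0)) * h0

theorem analyticAt_pull (f : V L) {z : ℂ} (hz : 2 * z ∉ L.lattice) : AnalyticAt ℂ (pull L f) z :=
  f.2.2.1 z (mk_mem_twoTorsion.not.2 hz)

theorem isSolution_iff {f k : V L} :
    IsSolution L f k ↔ ∀ z, 2 * z ∉ L.lattice → HasDerivAt (pull L k) (pull L f z ^ 2) z := by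
  simp only [IsSolution, mk_mem_twoTorsion]

theorem Psi_eq_zero_iff {f : V L} : Psi L f = 0 ↔
    (∫ t in (0 : ℝ)..1, pull L f (L.ω₂ / 4 + t * L.ω₁) ^ 2 * L.ω₁ = 0) ∧
      ∫ t in (0 : ℝ)..1, pull L f (L.ω₁ / 4 + t * L.ω₂) ^ 2 * L.ω₂ = 0 := by
  rw [Psi, LinearEquiv.map_eq_zero_iff, funext_iff, Fin.forall_fin_two]
  rfl

theorem integral_eq_zero_of_hasDerivAt {k : V L} {g : ℂ → ℂ} {z₀ ω : ℂ} (hω : ω ∈ L.lattice)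
    (hpath : ∀ t : ℝ, 2 * (z₀ + t * ω) ∉ L.lattice)
    (hk : ∀ z, 2 * z ∉ L.lattice → HasDerivAt (pull L k) (g z) z)
    (hg : ∀ z, 2 * z ∉ L.lattice → ContinuousAt g z) :
    ∫ t in (0 : ℝ)..1, g (z₀ + t * ω) * ω = 0 := by
  rw [integral_segment_eq_sub (fun t => hk _ (hpath t)) fun t => hg _ (hpath t),
    pull_add_mem _ _ hω, sub_self]

theorem Psi_eq_zero_of_isSolution {f k : V L} (hk : IsSolution L f k) : Psi L f = 0 := by
  rw [isSolution_iff] at hk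
  have hc : ∀ z, 2 * z ∉ L.lattice → ContinuousAt (fun z => pull L f z ^ 2) z := fun z hz =>
    (analyticAt_pull f hz).continuousAt.pow 2
  exact Psi_eq_zero_iff.2
    ⟨integral_eq_zero_of_hasDerivAt L.ω₁_mem_lattice L.two_mul_path₁_notMem hk hc,
      integral_eq_zero_of_hasDerivAt L.ω₂_mem_lattice L.two_mul_path₂_notMem hk hc⟩

theorem continuous_comp_segment {g : ℂ → ℂ} {z₀ ω : ℂ}
    (hpath : ∀ t : ℝ, 2 * (z₀ + t * ω) ∉ L.lattice)
    (hg : ∀ z, 2 * z ∉ L.lattice → ContinuousAt g z) :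
    Continuous fun t : ℝ => g (z₀ + t * ω) * ω := by
  refine Continuous.mul (continuous_iff_continuousAt.2 fun t => ?_) continuous_const
  exact ContinuousAt.comp (f := fun t : ℝ => z₀ + t * ω) (hg _ (hpath t)) (by fun_prop)

/-- The equations of the pencil of conics in the eigenbasis, where `e` are the values of `℘` at the
half periods. -/
def IsNull (e c : Fin 3 → ℂ) : Prop :=
  c 0 ^ 2 + c 1 ^ 2 + c 2 ^ 2 = 0 ∧ e 0 * c 0 ^ 2 + e 1 * c 1 ^ 2 + e 2 * c 2 ^ 2 = 0

/-- The values of `℘` at the three half periods. -/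
abbrev halfPeriodValues (L : PeriodPair) (w u v : ℂ) : Fin 3 → ℂ :=
  ![L.weierstrassP w, L.weierstrassP u, L.weierstrassP v]

theorem exists_isSolution_of_isNull {c : Fin 3 → ℂ} (hc : IsNull (halfPeriodValues L w u v) c) :
    ∃ k, IsSolution L (ofCoords h c) k := by
  obtain ⟨k, hk⟩ := hasDerivAt_pull_ofCoords_sq h c
  refine ⟨k, isSolution_iff.2 fun z hz => (hk z hz).congr_deriv ?_⟩
  have h1 := hc.1
  have h2 := hc.2
  simp only [Matrix.cons_val_zero, Matrix.cons_val_one, Matrix.cons_val] at h2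
  rw [h1, h2]
  ring

/-- Removing the exact part leaves `S ℘ + T` with the same periods, so `S` and `T` vanish by
`eq_zero_of_periods_eq_zero`. -/
theorem isNull_of_Psi_eq_zero {c : Fin 3 → ℂ} (hc : Psi L (ofCoords h c) = 0) :
    IsNull (halfPeriodValues L w u v) c := by
  obtain ⟨k, hk⟩ := hasDerivAt_pull_ofCoords_sq h c
  set S := 4 * (c 0 ^ 2 + c 1 ^ 2 + c 2 ^ 2) with hS
  set T := -4 * (L.weierstrassP w * c 0 ^ 2 + L.weierstrassP u * c 1 ^ 2 +
    L.weierstrassP v * c 2 ^ 2) with hT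
  set f := ofCoords h c
  have hf2 : ∀ z, 2 * z ∉ L.lattice → ContinuousAt (fun z => pull L f z ^ 2) z := fun z hz =>
    (analyticAt_pull f hz).continuousAt.pow 2
  have hd : ∀ z, 2 * z ∉ L.lattice →
      ContinuousAt (fun z => pull L f z ^ 2 - (S * L.weierstrassP z + T)) z := fun z hz =>
    (hf2 z hz).sub (((L.analyticOnNhd_weierstrassP z
      (notMem_of_two_mul_notMem hz)).continuousAt.const_mul S).add_const T)
  have key : ∀ z₀ ω : ℂ, ω ∈ L.lattice → (∀ t : ℝ, 2 * (z₀ + t * ω) ∉ L.lattice) →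
      ∫ t in (0 : ℝ)..1, pull L f (z₀ + t * ω) ^ 2 * ω = 0 →
      ∫ t in (0 : ℝ)..1, (S * L.weierstrassP (z₀ + t * ω) + T) * ω = 0 := by
    intro z₀ ω hω hpath hint
    have hk0 := integral_eq_zero_of_hasDerivAt hω hpath hk hd
    have hsub := intervalIntegral.integral_sub (μ := MeasureTheory.volume)
      ((continuous_comp_segment hpath hf2).intervalIntegrable 0 1)
      ((continuous_comp_segment hpath hd).intervalIntegrable 0 1)
    rw [hint, hk0, sub_zero] at hsub
    rw [← hsub]
    congr 1
    funext t
    ring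
  rw [Psi_eq_zero_iff] at hc
  obtain ⟨hS0, hT0⟩ := h.eq_zero_of_periods_eq_zero
    (key _ _ L.ω₁_mem_lattice L.two_mul_path₁_notMem hc.1)
    (key _ _ L.ω₂_mem_lattice L.two_mul_path₂_notMem hc.2)
  refine ⟨by linear_combination (1 / 4 : ℂ) * hS0, ?_⟩
  simp only [Matrix.cons_val_zero, Matrix.cons_val_one, Matrix.cons_val]
  linear_combination (-1 / 4 : ℂ) * hT0

theorem Psi_ofCoords_eq_zero_iff {c : Fin 3 → ℂ} :
    Psi L (ofCoords h c) = 0 ↔ IsNull (halfPeriodValues L w u v) c :=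
  ⟨isNull_of_Psi_eq_zero h, fun hc =>
    (exists_isSolution_of_isNull h hc).elim fun _ => Psi_eq_zero_of_isSolution⟩

include h in
theorem Psi_eq_zero_iff_exists_isSolution {f : V L} :
    Psi L f = 0 ↔ ∃ k, IsSolution L f k := by
  refine ⟨fun hf => ?_, fun ⟨_, hk⟩ => Psi_eq_zero_of_isSolution hk⟩
  obtain ⟨c, rfl⟩ := (ofCoords_bijective h).2 f
  exact exists_isSolution_of_isNull h (isNull_of_Psi_eq_zero h hf)

/-- Frees `Theta` from the choice of basis. -/
theorem mem_Theta_iff {b : Module.Basis (Fin 2) ℂ (H1 L)} {p : ℙ ℂ (V L)} :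
    p ∈ Theta L b ↔ ∀ f ∈ p.submodule, Psi L f = 0 := by
  simp only [Theta, quadric, Set.mem_inter_iff, Set.mem_ofPred_eq, Module.Basis.coord_apply]
  refine ⟨fun hp f hf => b.ext_elem fun i => ?_, fun hp =>
    ⟨fun f hf => by simp [hp f hf], fun f hf => by simp [hp f hf]⟩⟩
  fin_cases i
  · simpa using hp.1 f hf
  · simpa using hp.2 f hf

include h in
theorem Theta_eq_solutionLocus (b : Module.Basis (Fin 2) ℂ (H1 L)) :
    Theta L b = solutionLocus L := by
  ext p
  rw [mem_Theta_iff]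
  exact forall₂_congr fun f _ => Psi_eq_zero_iff_exists_isSolution h

theorem IsNull.smul {e c : Fin 3 → ℂ} (hc : IsNull e c) (a : ℂ) : IsNull e (a • c) := by
  refine ⟨?_, ?_⟩
  · simp only [Pi.smul_apply, smul_eq_mul]
    linear_combination a ^ 2 * hc.1
  · simp only [Pi.smul_apply, smul_eq_mul]
    linear_combination a ^ 2 * hc.2

theorem mk_ofCoords_mem_Theta_iff {b : Module.Basis (Fin 2) ℂ (H1 L)} {c : Fin 3 → ℂ}
    (hc : ofCoords h c ≠ 0) :
    Projectivization.mk ℂ (ofCoords h c) hc ∈ Theta L b ↔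
      IsNull (halfPeriodValues L w u v) c := by
  rw [mem_Theta_iff, Projectivization.submodule_mk]
  refine ⟨fun hp => isNull_of_Psi_eq_zero h (hp _ (Submodule.mem_span_singleton_self _)),
    fun hn f hf => ?_⟩
  obtain ⟨a, rfl⟩ := Submodule.mem_span_singleton.1 hf
  rw [← map_smul]
  exact (Psi_ofCoords_eq_zero_iff h).2 (hn.smul a)

/-! ### The `2`-torsion group and its action on the eigenbasis -/

/-- The `2`-torsion point represented by `z`. -/
def torsionPoint {z : ℂ} (hz : 2 * z ∈ L.lattice) : TwoTorsion L :=
  ⟨Submodule.Quotient.mk z, mk_mem_twoTorsion.2 hz⟩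

theorem pull_torsionPoint_smul {x : ℂ} (hx : 2 * x ∈ L.lattice) (f : V L) (z : ℂ) :
    pull L (Multiplicative.ofAdd (torsionPoint hx) • f : V L) z = pull L f (z + x) := rfl

/-- At `2`-torsion points oddness forces the value `0`, so identities proved off them suffice. -/
theorem V_ext {f g : V L} (hfg : ∀ z, 2 * z ∉ L.lattice → pull L f z = pull L g z) : f = g := by
  refine Subtype.ext (pull_injective fun z => ?_)
  by_cases hz : 2 * z ∈ L.lattice
  · rw [pull_of_two_mul_mem f hz, pull_of_two_mul_mem g hz]
  · exact hfg z hz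

theorem torsionPoint_left_smul (c : Fin 3 → ℂ) :
    Multiplicative.ofAdd (torsionPoint h.left.two_mul_mem) • ofCoords h c =
      ofCoords h ![c 0, -c 1, -c 2] := by
  refine V_ext fun z hz => ?_
  rw [pull_torsionPoint_smul, pull_ofCoords, pull_ofCoords, h.halfLogDeriv_add_self hz,
    h.halfLogDeriv_add hz, h.swap.halfLogDeriv_add hz]
  simp only [Matrix.cons_val_zero, Matrix.cons_val_one, Matrix.cons_val]
  ring

theorem torsionPoint_middle_smul (c : Fin 3 → ℂ) :
    Multiplicative.ofAdd (torsionPoint h.middle.two_mul_mem) • ofCoords h c =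
      ofCoords h ![-c 0, c 1, -c 2] := by
  refine V_ext fun z hz => ?_
  rw [pull_torsionPoint_smul, pull_ofCoords, pull_ofCoords, h.rotate.halfLogDeriv_add_self hz,
    h.rotate.halfLogDeriv_add hz, h.rotate.swap.halfLogDeriv_add hz]
  simp only [Matrix.cons_val_zero, Matrix.cons_val_one, Matrix.cons_val]
  ring

theorem torsionPoint_right_smul (c : Fin 3 → ℂ) :
    Multiplicative.ofAdd (torsionPoint h.right.two_mul_mem) • ofCoords h c =
      ofCoords h ![-c 0, -c 1, c 2] := by
  refine V_ext fun z hz => ?_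
  rw [pull_torsionPoint_smul, pull_ofCoords, pull_ofCoords,
    h.rotate.rotate.halfLogDeriv_add_self hz,
    h.rotate.rotate.halfLogDeriv_add hz, h.rotate.rotate.swap.halfLogDeriv_add hz]
  simp only [Matrix.cons_val_zero, Matrix.cons_val_one, Matrix.cons_val]
  ring

theorem twoTorsion_cases (k : TwoTorsion L) : k = 0 ∨ k = torsionPoint h.left.two_mul_mem ∨
    k = torsionPoint h.middle.two_mul_mem ∨ k = torsionPoint h.right.two_mul_mem := by
  obtain ⟨P, hP⟩ := k
  obtain ⟨z, rfl⟩ := Submodule.Quotient.mk_surjective _ P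
  simp only [torsionPoint, Subtype.ext_iff, ZeroMemClass.coe_zero, Submodule.Quotient.mk_eq_zero,
    Submodule.Quotient.eq]
  exact h.mem_of_two_mul_mem (mk_mem_twoTorsion.1 hP)

theorem torsionPoint_ne_zero {x : ℂ} (hx : L.IsHalfPeriod x) : torsionPoint hx.two_mul_mem ≠ 0 :=
  fun he => hx.notMem ((Submodule.Quotient.mk_eq_zero _).1 (congrArg Subtype.val he))

theorem torsionPoint_add_torsionPoint :
    torsionPoint h.left.two_mul_mem + torsionPoint h.middle.two_mul_mem =
      torsionPoint h.right.two_mul_mem := by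
  refine Subtype.ext ?_
  change (Submodule.Quotient.mk w + Submodule.Quotient.mk u : Curve L) = Submodule.Quotient.mk v
  rw [← Submodule.Quotient.mk_add, Submodule.Quotient.eq]
  exact (sub_mem_iff_add_mem h.right.two_mul_mem _).2 h.total_mem

theorem two_zsmul_twoTorsion (k : TwoTorsion L) : (2 : ℤ) • k = 0 := by
  obtain ⟨P, hP⟩ := k
  refine Subtype.ext ?_
  simpa using hP

/-- The homomorphism from `(ℤ/2)²` to the `2`-torsion that is given by two half periods. -/
def zmodHom : ZMod 2 × ZMod 2 →+ TwoTorsion L :=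
  (ZMod.lift 2 ⟨zmultiplesHom _ (torsionPoint h.left.two_mul_mem), two_zsmul_twoTorsion _⟩).coprod
    (ZMod.lift 2 ⟨zmultiplesHom _ (torsionPoint h.middle.two_mul_mem), two_zsmul_twoTorsion _⟩)

theorem zmodHom_apply (m n : ℤ) : zmodHom h (m, n) =
    m • torsionPoint h.left.two_mul_mem + n • torsionPoint h.middle.two_mul_mem := by
  simp only [zmodHom, AddMonoidHom.coprod_apply, ZMod.lift_coe, zmultiplesHom_apply]

theorem zmodHom_bijective : Function.Bijective (zmodHom h) := by
  have h10 : zmodHom h (1, 0) = torsionPoint h.left.two_mul_mem := by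
    simpa using zmodHom_apply h 1 0
  have h01 : zmodHom h (0, 1) = torsionPoint h.middle.two_mul_mem := by
    simpa using zmodHom_apply h 0 1
  have h11 : zmodHom h (1, 1) = torsionPoint h.right.two_mul_mem := by
    rw [← torsionPoint_add_torsionPoint h]
    simpa using zmodHom_apply h 1 1
  constructor
  · rw [injective_iff_map_eq_zero]
    rintro ⟨m, n⟩ hmn
    fin_cases m <;> fin_cases n
    · rfl
    · exact absurd (h01.symm.trans hmn) (torsionPoint_ne_zero h.middle)
    · exact absurd (h10.symm.trans hmn) (torsionPoint_ne_zero h.left)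
    · exact absurd (h11.symm.trans hmn) (torsionPoint_ne_zero h.right)
  · intro k
    rcases twoTorsion_cases h k with rfl | rfl | rfl | rfl
    · exact ⟨0, map_zero _⟩
    · exact ⟨_, h10⟩
    · exact ⟨_, h01⟩
    · exact ⟨_, h11⟩

/-- The `2`-torsion group is isomorphic to `(ℤ/2)²`. -/
def twoTorsionEquiv : TwoTorsion L ≃+ ZMod 2 × ZMod 2 :=
  (AddEquiv.ofBijective (zmodHom h) (zmodHom_bijective h)).symm

/-! ### The intersection of two diagonal conics -/

section Conics

variable {e c c' : Fin 3 → ℂ}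

/-- Both equations are linear in the squares, whose vector is thus proportional to the cross product
of `(1, 1, 1)` and `e`. -/
theorem IsNull.sq_eq (hc : IsNull e c) (h12 : e 1 - e 2 ≠ 0) :
    c 1 ^ 2 = c 0 ^ 2 / (e 1 - e 2) * (e 2 - e 0) ∧
      c 2 ^ 2 = c 0 ^ 2 / (e 1 - e 2) * (e 0 - e 1) := by
  constructor
  · field_simp
    linear_combination hc.2 - e 2 * hc.1
  · field_simp
    linear_combination e 1 * hc.1 - hc.2

theorem IsNull.ne_zero (hc : IsNull e c) (hc0 : c ≠ 0) (h01 : e 0 - e 1 ≠ 0) (h12 : e 1 - e 2 ≠ 0)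
    (h20 : e 2 - e 0 ≠ 0) : c 0 ≠ 0 ∧ c 1 ≠ 0 ∧ c 2 ≠ 0 := by
  obtain ⟨h1, h2⟩ := hc.sq_eq h12
  have h0 : c 0 ≠ 0 := fun h0 => by
    rw [h0] at h1 h2
    refine hc0 (funext fun i => ?_)
    fin_cases i
    · exact h0
    · simpa using h1
    · simpa using h2
  have hμ : c 0 ^ 2 / (e 1 - e 2) ≠ 0 := div_ne_zero (pow_ne_zero 2 h0) h12
  refine ⟨h0, fun hz => ?_, fun hz => ?_⟩
  · rw [hz, zero_pow two_ne_zero] at h1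
    exact mul_ne_zero hμ h20 h1.symm
  · rw [hz, zero_pow two_ne_zero] at h2
    exact mul_ne_zero hμ h01 h2.symm

theorem IsNull.exists_sign (hc : IsNull e c) (hc' : IsNull e c') (h12 : e 1 - e 2 ≠ 0)
    (h0 : c 0 ≠ 0) : ∃ a : ℂ, c' = a • c ∨ c' = a • ![c 0, -c 1, -c 2] ∨
      c' = a • ![-c 0, c 1, -c 2] ∨ c' = a • ![-c 0, -c 1, c 2] := by
  obtain ⟨h1, h2⟩ := hc.sq_eq h12
  obtain ⟨h1', h2'⟩ := hc'.sq_eq h12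
  set a := c' 0 / c 0
  have ha : c' 0 = a * c 0 := (div_mul_cancel₀ _ h0).symm
  have e1 : c' 1 ^ 2 = (a * c 1) ^ 2 := by
    rw [mul_pow, h1, h1', ha]; ring
  have e2 : c' 2 ^ 2 = (a * c 2) ^ 2 := by
    rw [mul_pow, h2, h2', ha]; ring
  have hext : ∀ x y z : ℂ, c' 0 = x → c' 1 = y → c' 2 = z → c' = ![x, y, z] := by
    intro x y z hx hy hz
    funext i
    fin_cases i
    · exact hx
    · exact hy
    · exact hz
  rcases sq_eq_sq_iff_eq_or_eq_neg.1 e1 with e1 | e1 <;>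
    rcases sq_eq_sq_iff_eq_or_eq_neg.1 e2 with e2 | e2
  · refine ⟨a, Or.inl (funext fun i => ?_)⟩
    fin_cases i
    · exact ha
    · exact e1
    · exact e2
  -- One sign change is projectively the same as changing the other two, hence the factor `-a`.
  · exact ⟨-a, Or.inr (Or.inr (Or.inr ((hext _ _ _ ha e1 e2).trans (by simp))))⟩
  · exact ⟨-a, Or.inr (Or.inr (Or.inl ((hext _ _ _ ha e1 e2).trans (by simp))))⟩
  · exact ⟨a, Or.inr (Or.inl ((hext _ _ _ ha e1 e2).trans (by simp)))⟩

theorem exists_isNull (h12 : e 1 - e 2 ≠ 0) : ∃ c, IsNull e c ∧ c ≠ 0 := by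
  obtain ⟨r, hr⟩ := IsAlgClosed.exists_pow_nat_eq (e 1 - e 2) two_pos
  obtain ⟨s, hs⟩ := IsAlgClosed.exists_pow_nat_eq (e 2 - e 0) two_pos
  obtain ⟨t, ht⟩ := IsAlgClosed.exists_pow_nat_eq (e 0 - e 1) two_pos
  refine ⟨![r, s, t], ⟨?_, ?_⟩, fun h0 => h12 ?_⟩
  · simp only [Matrix.cons_val_zero, Matrix.cons_val_one, Matrix.cons_val]
    rw [hr, hs, ht]; ring
  · simp only [Matrix.cons_val_zero, Matrix.cons_val_one, Matrix.cons_val]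
    rw [hr, hs, ht]; ring
  · have : r = 0 := congrFun h0 0
    rw [← hr, this]; simp

end Conics

/-! ### `Θ` as a free orbit of the `2`-torsion -/

theorem exists_mk_ofCoords (p : ℙ ℂ (V L)) :
    ∃ c, ∃ hc : ofCoords h c ≠ 0, p = Projectivization.mk ℂ (ofCoords h c) hc := by
  induction p using Projectivization.ind with
  | h f hf =>
    obtain ⟨c, rfl⟩ := (ofCoords_bijective h).2 f
    exact ⟨c, hf, rfl⟩

theorem smul_mk_ofCoords {k : Multiplicative (TwoTorsion L)} {c c' : Fin 3 → ℂ}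
    (hc : ofCoords h c ≠ 0) (hc' : ofCoords h c' ≠ 0) {a : ℂ}
    (hk : ofCoords h c' = a • (k • ofCoords h c)) :
    k • Projectivization.mk ℂ (ofCoords h c) hc = Projectivization.mk ℂ (ofCoords h c') hc' := by
  rw [Projectivization.smul_mk]
  exact ((Projectivization.mk_eq_mk_iff' ℂ _ _ _ _).2 ⟨a, hk.symm⟩).symm

theorem exists_smul_ofCoords_eq (k : Multiplicative (TwoTorsion L)) {e c : Fin 3 → ℂ}
    (hn : IsNull e c) : ∃ d, k • ofCoords h c = ofCoords h d ∧ IsNull e d := by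
  rcases twoTorsion_cases h k.toAdd with hk | hk | hk | hk <;> rw [← ofAdd_toAdd k, hk]
  · exact ⟨c, one_smul _ _, hn⟩
  · exact ⟨_, torsionPoint_left_smul h c, by simpa [IsNull] using hn⟩
  · exact ⟨_, torsionPoint_middle_smul h c, by simpa [IsNull] using hn⟩
  · exact ⟨_, torsionPoint_right_smul h c, by simpa [IsNull] using hn⟩

include h in
theorem orbit_eq_Theta (b : Module.Basis (Fin 2) ℂ (H1 L)) {p : ℙ ℂ (V L)} (hp : p ∈ Theta L b) :
    MulAction.orbit (Multiplicative (TwoTorsion L)) p = Theta L b := by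
  have h12 : (halfPeriodValues L w u v) 1 - (halfPeriodValues L w u v) 2 ≠ 0 :=
    sub_ne_zero.2 h.rotate.weierstrassP_ne
  obtain ⟨c, hc, rfl⟩ := exists_mk_ofCoords h p
  have hn := (mk_ofCoords_mem_Theta_iff h hc).1 hp
  have hc0 : c ≠ 0 := fun h0 => hc (by rw [h0, map_zero])
  obtain ⟨h0, -, -⟩ := hn.ne_zero hc0 (sub_ne_zero.2 h.weierstrassP_ne) h12
    (sub_ne_zero.2 h.rotate.rotate.weierstrassP_ne)
  ext q
  obtain ⟨c', hc', rfl⟩ := exists_mk_ofCoords h q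
  rw [mk_ofCoords_mem_Theta_iff, MulAction.mem_orbit_iff]
  constructor
  · rintro ⟨k, hk⟩
    obtain ⟨d, hd, hnd⟩ := exists_smul_ofCoords_eq h k hn
    obtain ⟨a, ha⟩ := (Projectivization.mk_eq_mk_iff' ℂ _ _ _ _).1 hk.symm
    change a • (k • ofCoords h c) = _ at ha
    rw [hd, ← map_smul] at ha
    obtain rfl := (ofCoords_bijective h).1 ha
    exact hnd.smul a
  · intro hn'
    obtain ⟨a, ha | ha | ha | ha⟩ := hn.exists_sign hn' h12 h0
    · exact ⟨1, smul_mk_ofCoords h hc hc' (a := a) (by rw [ha, map_smul, one_smul])⟩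
    · exact ⟨_, smul_mk_ofCoords h hc hc' (a := a) (by rw [ha, map_smul, torsionPoint_left_smul])⟩
    · exact ⟨_, smul_mk_ofCoords h hc hc' (a := a)
        (by rw [ha, map_smul, torsionPoint_middle_smul])⟩
    · exact ⟨_, smul_mk_ofCoords h hc hc' (a := a) (by rw [ha, map_smul, torsionPoint_right_smul])⟩

-- All coordinates are nonzero. A nontrivial translation keeps one and negates another, so the
-- scalar would be both `1` and `-1`.
include h in
theorem eq_one_of_smul_eq_self (b : Module.Basis (Fin 2) ℂ (H1 L)) {p : ℙ ℂ (V L)}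
    (hp : p ∈ Theta L b) {k : Multiplicative (TwoTorsion L)} (hk : k • p = p) : k = 1 := by
  obtain ⟨c, hc, rfl⟩ := exists_mk_ofCoords h p
  have hn := (mk_ofCoords_mem_Theta_iff h hc).1 hp
  have hc0 : c ≠ 0 := fun h0 => hc (by rw [h0, map_zero])
  obtain ⟨h0, h1, h2⟩ := hn.ne_zero hc0 (sub_ne_zero.2 h.weierstrassP_ne)
    (sub_ne_zero.2 h.rotate.weierstrassP_ne) (sub_ne_zero.2 h.rotate.rotate.weierstrassP_ne)
  rw [Projectivization.smul_mk, Projectivization.mk_eq_mk_iff'] at hk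
  obtain ⟨a, ha⟩ := hk
  have hab : ∀ {x y : ℂ}, x ≠ 0 → y ≠ 0 → a * x = x → a * y = -y → False := by
    intro x y hx hy hax hay
    have ha1 : a = 1 := mul_right_cancel₀ hx (by rw [hax, one_mul])
    rw [ha1, one_mul] at hay
    exact hy (CharZero.eq_neg_self_iff.1 hay)
  rcases twoTorsion_cases h k.toAdd with hk | hk | hk | hk
  · exact hk
  all_goals
    exfalso
    rw [← ofAdd_toAdd k, hk] at ha
  · rw [torsionPoint_left_smul, ← map_smul] at ha
    have ha := (ofCoords_bijective h).1 ha
    exact hab h0 h1 (congrFun ha 0) (congrFun ha 1)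
  · rw [torsionPoint_middle_smul, ← map_smul] at ha
    have ha := (ofCoords_bijective h).1 ha
    exact hab h1 h0 (congrFun ha 1) (congrFun ha 0)
  · rw [torsionPoint_right_smul, ← map_smul] at ha
    have ha := (ofCoords_bijective h).1 ha
    exact hab h2 h0 (congrFun ha 2) (congrFun ha 0)

-- `Θ` is nonempty by `exists_isNull`, and it is one free orbit of a group of order four.
include h in
theorem ncard_Theta (b : Module.Basis (Fin 2) ℂ (H1 L)) : (Theta L b).ncard = 4 := by
  obtain ⟨c, hn, hc0⟩ := exists_isNull (e := halfPeriodValues L w u v)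
    (sub_ne_zero.2 h.rotate.weierstrassP_ne)
  have hc : ofCoords h c ≠ 0 := by
    rw [Ne, ← map_zero (ofCoords h)]
    exact fun he => hc0 ((ofCoords_bijective h).1 he)
  have hp := (mk_ofCoords_mem_Theta_iff h (b := b) hc).2 hn
  rw [← orbit_eq_Theta h b hp]
  have hinj : Function.Injective fun k : Multiplicative (TwoTorsion L) =>
      k • Projectivization.mk ℂ (ofCoords h c) hc := fun k k' hkk' => by
    have : (k'⁻¹ * k) • Projectivization.mk ℂ (ofCoords h c) hc =
        Projectivization.mk ℂ (ofCoords h c) hc := by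
      rw [mul_smul, inv_smul_eq_iff]
      exact hkk'
    exact (inv_mul_eq_one.1 (eq_one_of_smul_eq_self h b hp this)).symm
  rw [MulAction.orbit, ← Nat.card_coe_set_eq, Nat.card_range_of_injective hinj,
    Nat.card_congr Multiplicative.toAdd, Nat.card_congr (twoTorsionEquiv h).toEquiv]
  simp

variable (L) in
theorem isHalfPeriodTriple : L.IsHalfPeriodTriple (L.ω₁ / 2) (L.ω₂ / 2) ((L.ω₁ + L.ω₂) / 2) := by
  have h1 := L.ω₁_mem_lattice
  have h2 := L.ω₂_mem_lattice
  refine ⟨⟨L.ω₁_div_two_notMem_lattice, ?_⟩, ⟨L.ω₂_div_two_notMem_lattice, ?_⟩, ⟨fun hm => ?_, ?_⟩,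
    ?_⟩
  · convert h1 using 1; ring
  · convert h2 using 1; ring
  · have := (L.mul_ω₁_add_mul_ω₂_mem_lattice (α := 1 / 2) (β := 1 / 2)).1 (by
      convert hm using 1
      push_cast
      ring)
    norm_num at this
  · convert add_mem h1 h2 using 1; ring
  · convert add_mem h1 h2 using 1; ring

end OddElliptic

end

end

theorem mainTheorem8 (L : PeriodPair) (b : Module.Basis (Fin 2) ℂ (OddElliptic.H1 L)) :
    Module.finrank ℂ (OddElliptic.V L) = 3 ∧
    Nonempty (OddElliptic.TwoTorsion L ≃+ ZMod 2 × ZMod 2) ∧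
    OddElliptic.Theta L b = OddElliptic.solutionLocus L ∧
    (OddElliptic.Theta L b).ncard = 4 ∧
    ∀ p ∈ OddElliptic.Theta L b,
      MulAction.orbit (Multiplicative (OddElliptic.TwoTorsion L)) p = OddElliptic.Theta L b :=
  have h := OddElliptic.isHalfPeriodTriple L
  ⟨OddElliptic.finrank_V h, ⟨OddElliptic.twoTorsionEquiv h⟩, OddElliptic.Theta_eq_solutionLocus h b,
    OddElliptic.ncard_Theta h b, fun _ hp => OddElliptic.orbit_eq_Theta h b hp⟩
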